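/- Let $n\ge 1$, let $\mu$ be Lebesgue measure on $\mathbb R^n$ and $|\cdot|$ the Euclidean norm. A Young function is a convex increasing $N:[0,\infty)\to[0,\infty]$ with $N(0)=0$, $\lim_{s\to\infty}N(s)=\infty$, and $N(s)<\infty$ for some $s>0$. For an increasing $N:[0,\infty)\to[0,\infty]$ and measurable $f:\mathbb R^n\to\mathbb R$ let $\|f\|_N=\inf\{r>0:\int_{\mathbb R^n}N(|f(x)|/r)\,dx\le 1\}$ ($\inf\emptyset=\infty$) and $L_N(\mathbb R^n)=\{f \text{ measurable}:\|f\|_N<\infty\}$. Write $N_1\not\preceq N_2$ ("$N_1$ is not dominated by $N_2$") if $\sup_{s>0}N_1(s)/N_2(s)=\infty$, where $\frac00=\frac\infty\infty=1$, $\frac r0=\infty$ and $\frac r\infty=0$ for $r>0$. For an increasing $F:[0,\infty)\to[0,\infty]$ let $F^{-1}(r)=\inf\{s>0:F(s)\ge r\}$ ($\inf\emptyset=\infty$). For $\alpha\in(0,2)$ let $\mathscr H_\alpha$ be the class of functions $h:(0,\infty)\to(0,\infty)$ such that $h(s)$ and $s/h(s)$ are (weakly) increasing in $s$ and $$\Phi_h(s):=\int_0^s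 dt\int_0^{t^{-1/n}}\frac{r^{\alpha-1}}{h(r)}\,dr<\infty,\qquad s>0.$$ Let $N_h:=\Phi_h^{-1}$. **Theorem.** For any $\alpha\in(0,2)$ and $h\in\mathscr H_\alpha$ there is a constant $C>0$ such that $$\|f\|_{N_h}\le C\int_{\mathbb R^n\times\mathbb R^n}|f(x)-f(y)|\,\frac{h(|x-y|)}{|x-y|^{n+\alpha}}\,dx\,dy,\qquad f\in L_{N_h}(\mathbb R^n),\tag{ON}$$ and moreover $$\inf_{\mu(A)\in(0,\infty)}\Big(N_h^{-1}\big(\mu(A)^{-1}\big)\int_{A\times A^c}\frac{h(|x-y|)}{|x-y|^{n+\alpha}}\,dx\,dy\Big)>0,\tag{ON'}$$ the infimum being over measurable sets $A\subset\mathbb R^n$. Furthermore: (1) For any $\alpha_1,\alpha_2\in(0,2)$ let $N^\land(s)=s^{\frac n{n-\alpha_1/2}}\land s^{\frac n{n-\alpha_2/2}}$ and $N^\lor(s)=s^{\frac n{n-\alpha_1/2}}\lor s^{\frac n{n-\alpha_2/2}}$. There is a constant $C>0$ such that $$\|f\|_{N^\land}\le C\int_{\mathbb R^n\times\mathbb R^n}\frac{|f(x)-f(y)|}{|x-y|^{n+\alpha_1/2}\lor|x-y|^{n+\alpha_2/2}}\,dx\,dy,\qquad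 f\in L_{N^\land}(\mathbb R^n),\tag{N1}$$ $$\|f\|_{N^\lor}\le C\int_{\mathbb R^n\times\mathbb R^n}\frac{|f(x)-f(y)|}{|x-y|^{n+\alpha_1/2}\land|x-y|^{n+\alpha_2/2}}\,dx\,dy,\qquad f\in L_{N^\lor}(\mathbb R^n).\tag{N2}$$ These are sharp: (N1) (resp. (N2)) fails for every constant $C>0$ if $N^\land$ (resp. $N^\lor$) is replaced by a Young function $N\not\preceq N^\land$ (resp. $N\not\preceq N^\lor$). (2) For any $\alpha\in(0,2)$ and $q,p\in\mathbb R$ let $$N^{+}_\lambda(s)=\{s\log^q(\lambda+s)\}^{\frac n{n-\alpha/2}},\qquad N^{-}_\lambda(s)=\{s\log^p(\lambda+s^{-1})\}^{\frac n{n-\alpha/2}},\quad N^-_\lambda(0)=0.$$ For all sufficiently large $\lambda\ge2$ both are Young functions. For every $\lambda\ge 2$ such that both are Young functions, there is a constant $C>0$ such that $$\|f\|_{N^{+}_\lambda}\le C\int_{\mathbb R^n\times\mathbb R^n}|f(x)-f(y)|\,\frac{\{\log(2+|x-y|^{-1})\}^q}{|x-y|^{n+\alpha/2}}\,dx\,dy,\qquad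 f\in L_{N^{+}_\lambda}(\mathbb R^n),\tag{*21}$$ $$\|f\|_{N^{-}_\lambda}\le C\int_{\mathbb R^n\times\mathbb R^n}|f(x)-f(y)|\,\frac{\{\log(2+|x-y|)\}^p}{|x-y|^{n+\alpha/2}}\,dx\,dy,\qquad f\in L_{N^{-}_\lambda}(\mathbb R^n).\tag{*22}$$ These are sharp: (*21) (resp. (*22)) fails for every constant $C>0$ if $N^{+}_\lambda$ (resp. $N^{-}_\lambda$) is replaced by a Young function $N\not\preceq N^{+}_\lambda$ (resp. $N\not\preceq N^{-}_\lambda$). -/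

import Mathlib

open MeasureTheory
open scoped NNReal ENNReal Topology

namespace OrliczIso

/-- Euclidean space `ℝⁿ`, with its Euclidean norm and Lebesgue measure. -/
abbrev Rn (n : ℕ) : Type := EuclideanSpace ℝ (Fin n)

/-- Young functions `N : [0,∞) → [0,∞]`: convex, increasing, `N 0 = 0` and `N(∞) = ∞`.
The last field excludes the degenerate function that is `∞` on all of `(0,∞)`. -/
structure IsYoung (N : ℝ≥0 → ℝ≥0∞) : Prop where
  convex : ConvexOn ℝ≥0 Set.univ N
  mono : Monotone N
  zero : N 0 = 0
  tendsto : Filter.Tendsto N Filter.atTop (𝓝 ⊤)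
  finite : ∃ s : ℝ≥0, 0 < s ∧ N s ≠ ⊤

/-- The norm `‖f‖_N = inf {r > 0 : ∫ N(|f(x)|/r) dx ≤ 1}`, with `inf ∅ = ∞`. -/
noncomputable def orliczNorm {n : ℕ} (N : ℝ≥0 → ℝ≥0∞) (f : Rn n → ℝ) : ℝ≥0∞ :=
  ⨅ (r : ℝ≥0) (_ : 0 < r ∧ ∫⁻ x, N (‖f x‖₊ / r) ≤ 1), (r : ℝ≥0∞)

/-- `f ∈ L_N(ℝⁿ)`. -/
def MemOrlicz {n : ℕ} (N : ℝ≥0 → ℝ≥0∞) (f : Rn n → ℝ) : Prop :=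
  Measurable f ∧ orliczNorm N f < ⊤

/-- The quotient `a / b` with `0/0 = 1`, `∞/∞ = 1`, `r/0 = ∞`, `r/∞ = 0`. -/
noncomputable def ratio (a b : ℝ≥0∞) : ℝ≥0∞ :=
  open Classical in
  if (a = 0 ∧ b = 0) ∨ (a = ⊤ ∧ b = ⊤) then 1 else a / b

/-- `N₁` is not dominated by `N₂`: `sup_{s>0} N₁(s)/N₂(s) = ∞`. -/
def NotDominated (N₁ N₂ : ℝ≥0 → ℝ≥0∞) : Prop :=
  (⨆ (s : ℝ≥0) (_ : 0 < s), ratio (N₁ s) (N₂ s)) = ⊤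

/-- The inverse of an increasing function: `F⁻¹(r) = inf {s > 0 : F(s) ≥ r}`, `inf ∅ = ∞`. -/
noncomputable def genInv (F : ℝ≥0 → ℝ≥0∞) (r : ℝ≥0∞) : ℝ≥0∞ :=
  ⨅ (s : ℝ≥0) (_ : 0 < s ∧ r ≤ F s), (s : ℝ≥0∞)

/-- `Φ_h(s) = ∫₀^s dt ∫₀^{t^{-1/n}} r^{α-1} / h(r) dr`. -/
noncomputable def Phi (n : ℕ) (α : ℝ) (h : ℝ → ℝ) (s : ℝ≥0) : ℝ≥0∞ :=
  ∫⁻ t in Set.Ioc (0 : ℝ) (s : ℝ), ∫⁻ r in Set.Ioc (0 : ℝ) (t ^ (-(1 / (n : ℝ)))),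
    ENNReal.ofReal (r ^ (α - 1) / h r)

/-- The class `H_α` of functions `h : (0,∞) → (0,∞)` (values off `(0,∞)` are irrelevant). -/
structure MemH (n : ℕ) (α : ℝ) (h : ℝ → ℝ) : Prop where
  pos : ∀ s, 0 < s → 0 < h s
  mono : MonotoneOn h (Set.Ioi 0)
  mono_div : MonotoneOn (fun s => s / h s) (Set.Ioi 0)
  finite : ∀ s : ℝ≥0, 0 < s → Phi n α h s < ⊤

/-- `N_h = Φ_h⁻¹`. -/
noncomputable def Nh (n : ℕ) (α : ℝ) (h : ℝ → ℝ) (s : ℝ≥0) : ℝ≥0∞ :=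
  genInv (Phi n α h) (s : ℝ≥0∞)

/-- `∫∫ |f(x) - f(y)| K(|x-y|) dx dy`. The diagonal is a null set. -/
noncomputable def energy {n : ℕ} (K : ℝ → ℝ) (f : Rn n → ℝ) : ℝ≥0∞ :=
  ∫⁻ p : Rn n × Rn n, ENNReal.ofReal (|f p.1 - f p.2| * K ‖p.1 - p.2‖)

/-- `∫_{A × Aᶜ} K(|x-y|) dx dy`. -/
noncomputable def perimeter {n : ℕ} (K : ℝ → ℝ) (A : Set (Rn n)) : ℝ≥0∞ :=
  ∫⁻ p : Rn n × Rn n in A ×ˢ Aᶜ, ENNReal.ofReal (K ‖p.1 - p.2‖)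

/-- `‖f‖_N ≤ C ∫∫ |f(x) - f(y)| K(|x-y|) dx dy` for all `f ∈ L_N(ℝⁿ)`. -/
def OrliczSobolev (n : ℕ) (N : ℝ≥0 → ℝ≥0∞) (K : ℝ → ℝ) (C : ℝ) : Prop :=
  ∀ f : Rn n → ℝ, MemOrlicz N f → orliczNorm N f ≤ ENNReal.ofReal C * energy K f

/-- The inequality with kernel `K` fails for every Young function not dominated by `N₀`. -/
def Sharp (n : ℕ) (N₀ : ℝ≥0 → ℝ≥0∞) (K : ℝ → ℝ) : Prop :=
  ∀ N : ℝ≥0 → ℝ≥0∞, IsYoung N → NotDominated N N₀ →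
    ¬ ∃ C : ℝ, 0 < C ∧ OrliczSobolev n N K C

/-- The kernel `h(r) / r^{n+α}`. -/
noncomputable def kerH (n : ℕ) (α : ℝ) (h : ℝ → ℝ) (r : ℝ) : ℝ :=
  h r / r ^ ((n : ℝ) + α)

/-- The exponent `n / (n - α/2)`. -/
noncomputable def expo (n : ℕ) (α : ℝ) : ℝ := (n : ℝ) / ((n : ℝ) - α / 2)

/-- `s^{n/(n-α₁/2)} ∧ s^{n/(n-α₂/2)}`. -/
noncomputable def Nmin (n : ℕ) (α₁ α₂ : ℝ) (s : ℝ≥0) : ℝ≥0∞ :=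
  ((min (s ^ expo n α₁) (s ^ expo n α₂) : ℝ≥0) : ℝ≥0∞)

/-- `s^{n/(n-α₁/2)} ∨ s^{n/(n-α₂/2)}`. -/
noncomputable def Nmax (n : ℕ) (α₁ α₂ : ℝ) (s : ℝ≥0) : ℝ≥0∞ :=
  ((max (s ^ expo n α₁) (s ^ expo n α₂) : ℝ≥0) : ℝ≥0∞)

/-- `1 / (r^{n+α₁/2} ∨ r^{n+α₂/2})`. -/
noncomputable def kerMax (n : ℕ) (α₁ α₂ : ℝ) (r : ℝ) : ℝ :=
  1 / max (r ^ ((n : ℝ) + α₁ / 2)) (r ^ ((n : ℝ) + α₂ / 2))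

/-- `1 / (r^{n+α₁/2} ∧ r^{n+α₂/2})`. -/
noncomputable def kerMin (n : ℕ) (α₁ α₂ : ℝ) (r : ℝ) : ℝ :=
  1 / min (r ^ ((n : ℝ) + α₁ / 2)) (r ^ ((n : ℝ) + α₂ / 2))

/-- `{s log^q(lam + s)}^{n/(n-α/2)}`. -/
noncomputable def NlogPlus (n : ℕ) (α q lam : ℝ) (s : ℝ≥0) : ℝ≥0∞ :=
  ENNReal.ofReal (((s : ℝ) * Real.log (lam + s) ^ q) ^ expo n α)

/-- `{s log^p(lam + 1/s)}^{n/(n-α/2)}` (equal to `0` at `s = 0`). -/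
noncomputable def NlogMinus (n : ℕ) (α p lam : ℝ) (s : ℝ≥0) : ℝ≥0∞ :=
  ENNReal.ofReal (((s : ℝ) * Real.log (lam + (s : ℝ)⁻¹) ^ p) ^ expo n α)

/-- `{log(2 + 1/r)}^q / r^{n+α/2}`. -/
noncomputable def kerLogPlus (n : ℕ) (α q : ℝ) (r : ℝ) : ℝ :=
  Real.log (2 + r⁻¹) ^ q / r ^ ((n : ℝ) + α / 2)

/-- `{log(2 + r)}^p / r^{n+α/2}`. -/
noncomputable def kerLogMinus (n : ℕ) (α p : ℝ) (r : ℝ) : ℝ :=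
  Real.log (2 + r) ^ p / r ^ ((n : ℝ) + α / 2)

end OrliczIso

open MeasureTheory
open scoped NNReal ENNReal Topology

namespace OrliczIso

/-! Everything is governed by the profile R^{2n} K(R), the order of the K-perimeter of a ball of
radius R.

Isoperimetry. If A has volume R^n, every x in A sees volume at least R^n of the complement within
distance mR, where the ball of radius mR has volume 2R^n. Regularity of K bounds K below on that
ball by a multiple of K(R), so the perimeter of A is at least a constant times the profile
(`PowerRegular.perimeter_ge`).

From sets to functions. By coarea, the perimeters P(t) of the level sets {|f| > t} integrate to at
most the energy. Let Q be a constant times P, with integral T, and suppose that the isoperimetric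
bound reads |{|f| > t}| N(1/Q(t)) ≤ 1. A star-shaped N satisfies b/u ≤ q N(1/q) + b q whenever b ≤
N(u), in place of a supporting line. Taking u = |f(x)|/(2T), q = Q(t) and integrating over 0 < t <
|f(x)| gives T N(|f(x)|/(2T)) ≤ ∫ Q(t) N(1/Q(t)) dt over the same range. Integrating in x and
applying Fubini and the isoperimetric bound yields ∫ N(|f|/(2T)) ≤ 1, so the norm is at most 2T
(`orliczSobolev_of_perimeter`). All inequalities thus reduce to N(c/profile(R)) ≤ C/R^n.

Sharpness. A tent of radius R has energy at most a constant times the profile, provided that the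
exponents controlling K lie strictly between n and n+1. Testing the inequality on it gives N(s) ≤
C/R^n as soon as s is at most a small multiple of 1/profile(R) (`PowerRegular.sharp`). If such an R
can be chosen with 1/R^n ≤ C N₀(s), then N is dominated by N₀.

What remains is to compare each N with its profile. For h, the monotonicity of h gives Φ_h(R^{-n}) ≥
c/profile(R). For powers, 1/profile is the exact inverse of N at R^{-n}. For logarithms it is an
inverse up to constants, because log(2 + y^β log^q(2+y)) is comparable with log(2+y). The
logarithmic functions are Young for large λ because, in the variable log s, they are small C²
perturbations of a power with exponent above 1. -/

/-! ### Star-shaped functions -/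

/-- `N` lies below its chords from the origin; equivalently `N 0 = 0` and `N(u)/u` increases. -/
def StarShaped (N : ℝ≥0 → ℝ≥0∞) : Prop :=
  ∀ a u : ℝ≥0, a ≤ 1 → N (a * u) ≤ a * N u

lemma StarShaped.zero {N : ℝ≥0 → ℝ≥0∞} (hN : StarShaped N) : N 0 = 0 := by
  have h := hN 0 0 zero_le_one
  simpa using h

lemma StarShaped.mono {N : ℝ≥0 → ℝ≥0∞} (hN : StarShaped N) : Monotone N := by
  intro u v huv
  rcases eq_or_ne v 0 with rfl | hv
  · rw [le_antisymm huv (zero_le)]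
  have h1 : u / v ≤ 1 := div_le_one_of_le₀ huv (zero_le)
  have h := hN (u / v) v h1
  rw [div_mul_cancel₀ _ hv] at h
  exact h.trans (mul_le_of_le_one_left (zero_le) (by exact_mod_cast h1))

lemma IsYoung.starShaped {N : ℝ≥0 → ℝ≥0∞} (hN : IsYoung N) : StarShaped N := by
  intro a u ha
  have h := hN.convex.2 (Set.mem_univ u) (Set.mem_univ 0) (zero_le : 0 ≤ a)
    (zero_le : 0 ≤ 1 - a) (add_tsub_cancel_of_le ha)
  simpa [hN.zero, ENNReal.smul_def] using h

/-- Substitute for a supporting line of a star-shaped function. -/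
lemma StarShaped.le_add {N : ℝ≥0 → ℝ≥0∞} (hN : StarShaped N) {b u : ℝ≥0} (hu : 0 < u)
    (hb : (b : ℝ≥0∞) ≤ N u) (v : ℝ≥0) : ((b * v / u : ℝ≥0) : ℝ≥0∞) ≤ N v + b := by
  rcases le_total v u with hvu | huv
  · refine le_trans ?_ le_add_self
    norm_cast
    rw [mul_div_assoc]
    exact mul_le_of_le_one_right (zero_le) (div_le_one_of_le₀ hvu (zero_le))
  · refine le_trans ?_ le_self_add
    have hv : 0 < v := hu.trans_le huv
    have h := hN (u / v) v (div_le_one_of_le₀ huv (zero_le))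
    rw [div_mul_cancel₀ _ hv.ne'] at h
    calc ((b * v / u : ℝ≥0) : ℝ≥0∞) = ((v / u : ℝ≥0) : ℝ≥0∞) * b := by
          norm_cast; rw [mul_comm b, mul_div_right_comm]
      _ ≤ ((v / u : ℝ≥0) : ℝ≥0∞) * (((u / v : ℝ≥0) : ℝ≥0∞) * N v) := by
          gcongr; exact hb.trans h
      _ = N v := by
          rw [← mul_assoc, ← ENNReal.coe_mul, div_mul_div_cancel₀ hu.ne', div_self hv.ne']
          simp

/-- This is `StarShaped.le_add` at v = 1/q, multiplied by q. It will be integrated over levels t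
with q = Q(t). -/
lemma StarShaped.le_mul_add {N : ℝ≥0 → ℝ≥0∞} (hN : StarShaped N) {b u : ℝ≥0} (hu : 0 < u)
    (hb : (b : ℝ≥0∞) ≤ N u) {q : ℝ≥0∞} (hq : q ≠ 0) :
    ((b / u : ℝ≥0) : ℝ≥0∞) ≤ N (q⁻¹).toNNReal * q + b * q := by
  induction q with
  | top =>
    rcases eq_or_ne b 0 with rfl | hb0
    · simp
    · simp [hb0]
  | coe q =>
    have hq0 : q ≠ 0 := by simpa using hq
    have h := mul_le_mul_left (hN.le_add hu hb q⁻¹) (q : ℝ≥0∞)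
    rw [← ENNReal.coe_inv hq0, ENNReal.toNNReal_coe, ← add_mul]
    refine le_trans (le_of_eq ?_) h
    norm_cast
    field_simp

/-! ### Coarea and the passage from perimeters to functions -/

/-- A pair (x, y) is cut by the level t exactly when |f(y)| ≤ t < |f(x)|, a set of levels of length
at most |f(x) - f(y)|. -/
lemma energy_coarea {n : ℕ} {K : ℝ → ℝ} (hK : Measurable ((Set.Ioi 0).indicator K))
    {f : Rn n → ℝ} (hf : Measurable f) :
    Measurable (fun t : ℝ => perimeter K {x | t < |f x|}) ∧
      ∫⁻ t in Set.Ioi (0 : ℝ), perimeter K {x | t < |f x|} ≤ energy K f := by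
  -- `K` is arbitrary off (0,∞). Truncating it restores measurability and changes nothing off the
  -- diagonal, which A × Aᶜ does not meet.
  set k : Rn n × Rn n → ℝ≥0∞ :=
    fun p => ENNReal.ofReal ((Set.Ioi 0).indicator K ‖p.1 - p.2‖) with hk
  have hkm : Measurable k := by
    rw [hk]; exact (hK.comp (by fun_prop)).ennreal_ofReal
  have hkK : ∀ p : Rn n × Rn n, p.1 ≠ p.2 → ENNReal.ofReal (K ‖p.1 - p.2‖) = k p := by
    intro p hp
    simp [hk, sub_eq_zero, hp]
  set S : Set (ℝ × (Rn n × Rn n)) := {z | z.1 < |f z.2.1| ∧ |f z.2.2| ≤ z.1} with hS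
  have hSm : MeasurableSet S := by
    have h1 : MeasurableSet {z : ℝ × (Rn n × Rn n) | z.1 < |f z.2.1|} :=
      measurableSet_lt (by fun_prop) (by fun_prop)
    have h2 : MeasurableSet {z : ℝ × (Rn n × Rn n) | |f z.2.2| ≤ z.1} :=
      measurableSet_le (by fun_prop) (by fun_prop)
    exact h1.inter h2
  set F : ℝ × (Rn n × Rn n) → ℝ≥0∞ := S.indicator (fun z => k z.2) with hF
  have hFm : Measurable F := (hkm.comp measurable_snd).indicator hSm
  have hper : ∀ t, perimeter K {x | t < |f x|} = ∫⁻ p, F (t, p) := by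
    intro t
    have hA : MeasurableSet {x | t < |f x|} := measurableSet_lt measurable_const (by fun_prop)
    rw [perimeter, ← lintegral_indicator (hA.prod hA.compl)]
    refine lintegral_congr fun p => ?_
    by_cases hp : t < |f p.1| ∧ |f p.2| ≤ t
    · rw [Set.indicator_of_mem (by simpa using hp), hF, Set.indicator_of_mem (by simpa [hS] using hp)]
      refine hkK p fun h => ?_
      rw [h] at hp
      exact absurd hp.1 (not_lt.2 hp.2)
    · rw [Set.indicator_of_notMem (by simpa using hp), hF,
        Set.indicator_of_notMem (by simpa [hS] using hp)]
  simp_rw [hper]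
  refine ⟨hFm.lintegral_prod_right', ?_⟩
  rw [lintegral_lintegral_swap (by exact hFm.aemeasurable)]
  refine lintegral_mono fun p => ?_
  have hle : ∀ t, F (t, p) ≤ (Set.Ico |f p.2| |f p.1|).indicator (fun _ => k p) t := by
    intro t
    by_cases hp : t < |f p.1| ∧ |f p.2| ≤ t
    · rw [Set.indicator_of_mem (Set.mem_Ico.2 ⟨hp.2, hp.1⟩), hF,
        Set.indicator_of_mem (by simpa [hS] using hp)]
    · rw [hF, Set.indicator_of_notMem (by simpa [hS] using hp)]
      exact zero_le
  calc ∫⁻ t in Set.Ioi 0, F (t, p)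
      ≤ ∫⁻ t, (Set.Ico |f p.2| |f p.1|).indicator (fun _ => k p) t :=
        (setLIntegral_le_lintegral _ _).trans (lintegral_mono hle)
    _ = k p * ENNReal.ofReal (|f p.1| - |f p.2|) := by
        rw [lintegral_indicator_const measurableSet_Ico, Real.volume_Ico]
    _ ≤ ENNReal.ofReal (|f p.1 - f p.2| * K ‖p.1 - p.2‖) := by
        rw [ENNReal.ofReal_mul (abs_nonneg _), mul_comm]
        by_cases hp : p.1 = p.2
        · simp [hp]
        · rw [hkK p hp]
          gcongr
          exact abs_sub_abs_le_abs_sub _ _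

theorem orliczSobolev_of_perimeter {n : ℕ} {N : ℝ≥0 → ℝ≥0∞} {K : ℝ → ℝ} {C : ℝ≥0}
    (hC : 0 < C) (hN : StarShaped N) (hpos : ∀ s, 0 < s → 0 < N s)
    (hK : Measurable ((Set.Ioi 0).indicator K))
    (hI : ∀ A : Set (Rn n), MeasurableSet A → 0 < volume A → volume A < ⊤ →
      ∀ r : ℝ≥0, 0 < r → C * perimeter K A ≤ r → volume A * N r⁻¹ ≤ 1) :
    OrliczSobolev n N K (2 * C) := by
  rintro f ⟨hf, hfin⟩
  have hC2 : ENNReal.ofReal (2 * C) = 2 * C := by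
    rw [ENNReal.ofReal_mul zero_le_two, ENNReal.ofReal_coe_nnreal]; simp
  rw [hC2]
  obtain ⟨hPm, hPle⟩ := energy_coarea hK hf
  set P : ℝ → ℝ≥0∞ := fun t => perimeter K {x | t < |f x|} with hP
  have hAm : ∀ t, MeasurableSet {x | t < |f x|} := fun t =>
    measurableSet_lt measurable_const (by fun_prop)
  have hNm : Measurable N := hN.mono.measurable
  have hvol : ∀ t, 0 < t → volume {x | t < |f x|} < ⊤ := by
    intro t ht
    obtain ⟨r, hr⟩ := iInf_lt_iff.1 hfin
    obtain ⟨⟨hr0, hr1⟩, -⟩ := iInf_lt_iff.1 hr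
    have hpos' := hpos (t.toNNReal / r) (div_pos (Real.toNNReal_pos.2 ht) hr0)
    have hmeas : Measurable fun x => N (‖f x‖₊ / r) := hNm.comp (by fun_prop)
    -- Membership in the Orlicz space enters only here: by Markov, level sets have finite measure.
    -- The minimum with 1 keeps the threshold finite where N is infinite.
    have hch := (meas_ge_le_lintegral_div (μ := volume) (f := fun x => N (‖f x‖₊ / r))
      hmeas.aemeasurable (ε := min 1 (N (t.toNNReal / r))) (by simp [hpos'.ne']) (by simp))
    refine lt_of_le_of_lt (measure_mono ?_) (hch.trans_lt
      (ENNReal.div_lt_top (hr1.trans_lt ENNReal.one_lt_top).ne (by simp [hpos'.ne'])))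
    intro x hx
    refine le_trans (min_le_right _ _) (hN.mono ?_)
    gcongr
    rw [Real.toNNReal_le_iff_le_coe]
    exact (le_of_lt hx)
  by_cases hE : energy K f = ⊤
  · simp [hE, hC.ne']
  refine ENNReal.le_of_forall_pos_le_add fun ε hε _ => ?_
  -- A strictly positive η of small integral keeps Q from vanishing, so 1/Q makes sense and T > 0.
  obtain ⟨η, hη0, hηm, hηε⟩ := exists_pos_lintegral_lt_of_sigmaFinite
    (volume.restrict (Set.Ioi (0 : ℝ))) (ε := (ε / 2 : ℝ≥0)) (by simpa using hε.ne')
  set Q : ℝ → ℝ≥0∞ := fun t => C * P t + η t with hQ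
  have hQm : Measurable Q := (hPm.const_mul _).add hηm.coe_nnreal_ennreal
  have hQ0 : ∀ t, Q t ≠ 0 := fun t => by simp [hQ, (hη0 t).ne']
  have hT : ∫⁻ t in Set.Ioi 0, Q t ≤ C * energy K f + (ε / 2 : ℝ≥0) := by
    rw [hQ, lintegral_add_right _ hηm.coe_nnreal_ennreal, lintegral_const_mul _ hPm]
    gcongr
  have hTtop : ∫⁻ t in Set.Ioi 0, Q t ≠ ⊤ :=
    (hT.trans_lt (ENNReal.add_lt_top.2
      ⟨ENNReal.mul_lt_top ENNReal.coe_lt_top (lt_top_iff_ne_top.2 hE), ENNReal.coe_lt_top⟩)).ne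
  have hTpos : ∫⁻ t in Set.Ioi 0, Q t ≠ 0 := by
    refine (setLIntegral_pos_iff hQm).2 ?_ |>.ne'
    rw [Set.eq_univ_of_forall (s := Function.support Q) hQ0]
    simp
  obtain ⟨T, hTeq⟩ : ∃ T : ℝ≥0, (T : ℝ≥0∞) = ∫⁻ t in Set.Ioi 0, Q t :=
    ⟨_, ENNReal.coe_toNNReal hTtop⟩
  have hT0 : 0 < T := by
    rw [← hTeq] at hTpos; exact pos_iff_ne_zero.2 (by simpa using hTpos)
  set W : ℝ → ℝ≥0∞ := fun t => N ((Q t)⁻¹).toNNReal * Q t with hW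
  have hWm : Measurable W := (hNm.comp (hQm.inv.ennreal_toNNReal)).mul hQm
  have hpt : ∀ x, N (‖f x‖₊ / (2 * T)) * T ≤
      ∫⁻ t in Set.Ioi 0, {t | t < |f x|}.indicator W t := by
    intro x
    rw [← ENNReal.le_div_iff_mul_le (by simp [hT0.ne']) (by simp)]
    -- N may be infinite at this point; a finite b below it allows b T to be cancelled at the end.
    refine ENNReal.le_of_forall_nnreal_lt fun b hb => ?_
    rw [ENNReal.le_div_iff_mul_le (by simp [hT0.ne']) (by simp)]
    rcases eq_or_ne (f x) 0 with hx | hx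
    · simp [hx, hN.zero] at hb
    have hu : 0 < ‖f x‖₊ / (2 * T) := div_pos (by simpa using hx) (by positivity)
    have h1 : ∀ t, ((b / (‖f x‖₊ / (2 * T)) : ℝ≥0) : ℝ≥0∞) ≤ W t + b * Q t := fun t =>
      hN.le_mul_add hu hb.le (hQ0 t)
    have h2 : ∫⁻ t in Set.Ioo 0 |f x|, ((b / (‖f x‖₊ / (2 * T)) : ℝ≥0) : ℝ≥0∞) ≤
        ∫⁻ t in Set.Ioo 0 |f x|, (W t + b * Q t) := lintegral_mono h1
    rw [setLIntegral_const, Real.volume_Ioo, lintegral_add_left hWm, lintegral_const_mul _ hQm,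
      sub_zero, ← Real.norm_eq_abs, ofReal_norm, enorm_eq_nnnorm, ← ENNReal.coe_mul] at h2
    -- The factor 2 in 2T pays for the absorption: one b T cancels the error ∫ b Q, the other is the
    -- gain.
    have h3 : b / (‖f x‖₊ / (2 * T)) * ‖f x‖₊ = b * T + b * T := by
      have : ‖f x‖₊ ≠ 0 := by simpa using hx
      field_simp; ring
    rw [h3, Real.norm_eq_abs] at h2
    have h4 : ∫⁻ t in Set.Ioo 0 |f x|, Q t ≤ T := by
      rw [hTeq]; exact lintegral_mono_set Set.Ioo_subset_Ioi_self
    have h5 : ∫⁻ t in Set.Ioo 0 |f x|, W t ≤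
        ∫⁻ t in Set.Ioi 0, {t | t < |f x|}.indicator W t := by
      change _ ≤ ∫⁻ t in Set.Ioi 0, (Set.Iio |f x|).indicator W t
      rw [lintegral_indicator (measurableSet_Iio (a := |f x|)),
        Measure.restrict_restrict (measurableSet_Iio (a := |f x|))]
      refine lintegral_mono_set fun t ht => ⟨ht.2, ht.1⟩
    have h6 : (b * T : ℝ≥0∞) + b * T ≤
        (∫⁻ t in Set.Ioi 0, {t | t < |f x|}.indicator W t) + b * T := by
      push_cast at h2
      exact h2.trans (by gcongr)
    exact (ENNReal.add_le_add_iff_right (by finiteness)).1 h6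
  have hint : ∫⁻ x, N (‖f x‖₊ / (2 * T)) ≤ 1 := by
    have hfm : Measurable fun x => N (‖f x‖₊ / (2 * T)) := hNm.comp (by fun_prop)
    have h1 : (∫⁻ x, N (‖f x‖₊ / (2 * T))) * T ≤ T := by
      rw [← lintegral_mul_const _ hfm]
      refine (lintegral_mono hpt).trans ?_
      have hm : Measurable fun z : Rn n × ℝ => {t | t < |f z.1|}.indicator W z.2 := by
        have : (fun z : Rn n × ℝ => {t | t < |f z.1|}.indicator W z.2) =
          {z : Rn n × ℝ | z.2 < |f z.1|}.indicator (fun z => W z.2) := by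
          ext z; simp [Set.indicator]
        rw [this]
        exact (hWm.comp measurable_snd).indicator (measurableSet_lt (by fun_prop) (by fun_prop))
      -- After the swap the inner integral is |{|f| > t}| N(1/Q(t)) Q(t), at most Q(t) by the
      -- isoperimetric hypothesis with r = Q(t).
      rw [lintegral_lintegral_swap hm.aemeasurable, hTeq]
      refine setLIntegral_mono hQm fun t ht => ?_
      have : ∀ x, {t | t < |f x|}.indicator W t = {x | t < |f x|}.indicator (fun _ => W t) x := by
        intro x; simp [Set.indicator]
      simp_rw [this]
      rw [lintegral_indicator_const (hAm t)]
      rcases eq_or_ne (volume {x | t < |f x|}) 0 with h0 | h0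
      · simp [h0]
      rcases eq_or_ne (Q t) ⊤ with hQt | hQt
      · simp [hQt]
      obtain ⟨q, hq⟩ : ∃ q : ℝ≥0, (q : ℝ≥0∞) = Q t := ⟨_, ENNReal.coe_toNNReal hQt⟩
      have hq0 : 0 < q := by
        have := hQ0 t; rw [← hq] at this; exact pos_iff_ne_zero.2 (by simpa using this)
      have := hI _ (hAm t) (pos_iff_ne_zero.2 h0) (hvol t ht) q hq0
        (by rw [hq]; exact le_self_add)
      simp only [hW]
      rw [← hq, ← ENNReal.coe_inv hq0.ne', ENNReal.toNNReal_coe, mul_right_comm, mul_comm (N _)]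
      exact mul_le_of_le_one_left (zero_le) this
    rw [← ENNReal.le_div_iff_mul_le (by simp [hT0.ne']) (by simp),
      ENNReal.div_self (by simp [hT0.ne']) (by simp)] at h1
    exact h1
  calc orliczNorm N f ≤ ((2 * T : ℝ≥0) : ℝ≥0∞) :=
        iInf₂_le (2 * T) ⟨by positivity, hint⟩
    _ ≤ 2 * (C * energy K f + (ε / 2 : ℝ≥0)) := by
        rw [ENNReal.coe_mul, hTeq, ENNReal.coe_ofNat]; gcongr
    _ = 2 * C * energy K f + ε := by
        rw [mul_add, mul_assoc]; congr 1; norm_cast; field_simp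

lemma OrliczSobolev.mono {n : ℕ} {N : ℝ≥0 → ℝ≥0∞} {K : ℝ → ℝ} {C C' : ℝ}
    (h : OrliczSobolev n N K C) (hC : C ≤ C') : OrliczSobolev n N K C' := fun f hf =>
  (h f hf).trans (by gcongr)

/-! ### Regular kernels and the isoperimetric inequality -/

/-- `K` is positive on `(0,∞)` and its growth between two points is controlled by two powers. -/
structure PowerRegular (K : ℝ → ℝ) (e₁ e₂ : ℝ) : Prop where
  pos : ∀ r, 0 < r → 0 < K r
  bound : ∃ C : ℝ, 0 < C ∧ ∀ r R, 0 < r → 0 < R →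
    K r ≤ C * K R * max ((R / r) ^ e₁) ((R / r) ^ e₂)

/-- The isoperimetric profile of `K`, as a function of the radius. -/
noncomputable def profile (n : ℕ) (K : ℝ → ℝ) (R : ℝ) : ℝ := R ^ (2 * n) * K R

lemma PowerRegular.profile_pos {K : ℝ → ℝ} {e₁ e₂ : ℝ} (hK : PowerRegular K e₁ e₂) (n : ℕ)
    {R : ℝ} (hR : 0 < R) : 0 < profile n K R :=
  mul_pos (pow_pos hR _) (hK.pos R hR)

/-- With nonnegative exponents, `K` cannot be much smaller at shorter distances than at R, which is
all that the isoperimetric bound asks of it. -/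
lemma PowerRegular.exists_le {K : ℝ → ℝ} {e₁ e₂ : ℝ} (hK : PowerRegular K e₁ e₂)
    (he₁ : 0 ≤ e₁) (he₂ : 0 ≤ e₂) {m : ℝ} (hm : 0 < m) :
    ∃ c : ℝ, 0 < c ∧ ∀ R r, 0 < R → 0 < r → r ≤ m * R → c * K R ≤ K r := by
  obtain ⟨C, hC, hb⟩ := hK.bound
  have hM : 0 < max (m ^ e₁) (m ^ e₂) := lt_max_of_lt_left (by positivity)
  refine ⟨(C * max (m ^ e₁) (m ^ e₂))⁻¹, by positivity, fun R r hR hr hrR => ?_⟩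
  rw [inv_mul_le_iff₀ (by positivity)]
  have hq : r / R ≤ m := (div_le_iff₀ hR).2 hrR
  have hKr := hK.pos r hr
  calc K R ≤ C * K r * max ((r / R) ^ e₁) ((r / R) ^ e₂) := hb R r hR hr
    _ ≤ C * K r * max (m ^ e₁) (m ^ e₂) := by gcongr
    _ = C * max (m ^ e₁) (m ^ e₂) * K r := by ring

lemma volume_ball_one_pos (n : ℕ) : 0 < (volume (Metric.ball (0 : Rn n) 1)).toReal :=
  ENNReal.toReal_pos (Metric.measure_ball_pos _ _ one_pos).ne' measure_ball_lt_top.ne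

lemma volume_ball_eq {n : ℕ} (x : Rn n) {r : ℝ} (hr : 0 < r) :
    volume (Metric.ball x r) =
      ENNReal.ofReal (r ^ n * (volume (Metric.ball (0 : Rn n) 1)).toReal) := by
  rw [Measure.addHaar_ball_of_pos _ _ hr, ENNReal.ofReal_mul (by positivity),
    ENNReal.ofReal_toReal measure_ball_lt_top.ne, finrank_euclideanSpace, Fintype.card_fin]

/-- Sets of measure `Rⁿ` have `K`-perimeter at least a constant times the profile. -/
theorem PowerRegular.perimeter_ge {n : ℕ} (hn : 1 ≤ n) {K : ℝ → ℝ} {e₁ e₂ : ℝ}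
    (hK : PowerRegular K e₁ e₂) (he₁ : 0 ≤ e₁) (he₂ : 0 ≤ e₂) :
    ∃ c : ℝ, 0 < c ∧ ∀ (A : Set (Rn n)) (R : ℝ), MeasurableSet A → 0 < R →
      volume A = ENNReal.ofReal (R ^ n) → ENNReal.ofReal (c * profile n K R) ≤ perimeter K A := by
  set ω := (volume (Metric.ball (0 : Rn n) 1)).toReal with hω
  have hω0 : 0 < ω := volume_ball_one_pos n
  set m : ℝ := (2 / ω) ^ ((n : ℝ)⁻¹) with hm
  have hm0 : 0 < m := by positivity
  have hmn : m ^ n * ω = 2 := by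
    rw [hm, Real.rpow_inv_natCast_pow (by positivity) (by omega)]; field_simp
  obtain ⟨c, hc, hcK⟩ := hK.exists_le he₁ he₂ hm0
  refine ⟨c, hc, fun A R hA hR hAR => ?_⟩
  set U : Set (Rn n × Rn n) := {p | dist p.2 p.1 < m * R} with hU
  have hUm : MeasurableSet U := measurableSet_lt (by fun_prop) (by fun_prop)
  have hAm := hA.prod hA.compl
  have hvol : ENNReal.ofReal (R ^ (2 * n)) ≤ volume ((A ×ˢ Aᶜ) ∩ U) := by
    rw [Measure.volume_eq_prod, Measure.prod_apply (hAm.inter hUm)]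
    -- The ball of radius mR has volume 2R^n, of which A can occupy only R^n.
    have hslice : ∀ x, A.indicator (fun _ => ENNReal.ofReal (R ^ n)) x ≤
        volume (Prod.mk x ⁻¹' (A ×ˢ Aᶜ ∩ U)) := by
      intro x
      by_cases hx : x ∈ A
      · rw [Set.indicator_of_mem hx]
        have : Prod.mk x ⁻¹' (A ×ˢ Aᶜ ∩ U) = Metric.ball x (m * R) \ A := by
          ext y; simp [hx, hU, and_comm]
        rw [this]
        refine le_trans ?_ le_measure_sdiff
        rw [volume_ball_eq x (by positivity), hAR, ← ENNReal.ofReal_sub _ (by positivity)]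
        refine ENNReal.ofReal_le_ofReal (le_of_eq ?_)
        rw [mul_pow, ← hω, mul_right_comm, hmn]; ring
      · simp [hx]
    refine le_trans (le_of_eq ?_) (lintegral_mono hslice)
    rw [lintegral_indicator_const hA, hAR, ← ENNReal.ofReal_mul (by positivity)]
    ring_nf
  calc ENNReal.ofReal (c * profile n K R)
      = ENNReal.ofReal (c * K R) * ENNReal.ofReal (R ^ (2 * n)) := by
        rw [← ENNReal.ofReal_mul' (by positivity), profile]; ring_nf
    _ ≤ ENNReal.ofReal (c * K R) * volume ((A ×ˢ Aᶜ) ∩ U) := by gcongr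
    _ = ∫⁻ p in (A ×ˢ Aᶜ) ∩ U, ENNReal.ofReal (c * K R) := by rw [setLIntegral_const]
    _ ≤ ∫⁻ p in (A ×ˢ Aᶜ) ∩ U, ENNReal.ofReal (K ‖p.1 - p.2‖) := by
        refine setLIntegral_mono' (hAm.inter hUm) fun p hp => ?_
        refine ENNReal.ofReal_le_ofReal (hcK R _ hR ?_ ?_)
        · rw [norm_pos_iff, sub_ne_zero]
          rintro h
          exact hp.1.2 (h ▸ hp.1.1)
        · rw [← dist_eq_norm, dist_comm]; exact le_of_lt hp.2
    _ ≤ perimeter K A := lintegral_mono_set Set.inter_subset_left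

lemma exists_radius {n : ℕ} (hn : 1 ≤ n) {v : ℝ≥0∞} (h0 : 0 < v) (h1 : v < ⊤) :
    ∃ R : ℝ, 0 < R ∧ v = ENNReal.ofReal (R ^ n) := by
  have hv : 0 < v.toReal := ENNReal.toReal_pos h0.ne' h1.ne
  refine ⟨v.toReal ^ ((n : ℝ)⁻¹), by positivity, ?_⟩
  rw [Real.rpow_inv_natCast_pow hv.le (by omega), ENNReal.ofReal_toReal h1.ne]

theorem PowerRegular.exists_orliczSobolev {n : ℕ} (hn : 1 ≤ n) {N : ℝ≥0 → ℝ≥0∞} {K : ℝ → ℝ}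
    {e₁ e₂ : ℝ} (hK : PowerRegular K e₁ e₂) (he₁ : 0 ≤ e₁) (he₂ : 0 ≤ e₂)
    (hKm : Measurable ((Set.Ioi 0).indicator K)) (hN : StarShaped N)
    (hpos : ∀ s, 0 < s → 0 < N s) {C₁ C₂ : ℝ} (hC₁ : 0 < C₁)
    (hprof : ∀ R, 0 < R → N (C₁ / profile n K R).toNNReal ≤ ENNReal.ofReal (C₂ / R ^ n)) :
    ∃ C : ℝ, 0 < C ∧ OrliczSobolev n N K C := by
  obtain ⟨c, hc, hper⟩ := hK.perimeter_ge hn he₁ he₂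
  -- Enlarging the constant by D divides the argument of N by D; star-shapedness then divides its
  -- value by D, which absorbs C₂.
  set D : ℝ := max 1 C₂ with hD
  have hD1 : 1 ≤ D := le_max_left _ _
  have hD0 : 0 < D := by positivity
  set C : ℝ := D / (c * C₁) with hCdef
  have hC : 0 < C := by positivity
  refine ⟨2 * (C.toNNReal : ℝ), by rw [Real.coe_toNNReal _ hC.le]; positivity,
    orliczSobolev_of_perimeter (Real.toNNReal_pos.2 hC) hN hpos hKm ?_⟩
  intro A hA hA0 hA1 r hr hPr
  obtain ⟨R, hR, hAR⟩ := exists_radius hn hA0 hA1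
  have hp := hK.profile_pos n hR
  have hr' : C * (c * profile n K R) ≤ r := by
    have h1 : ENNReal.ofReal (C * (c * profile n K R)) ≤ r := by
      rw [ENNReal.ofReal_mul hC.le]
      refine le_trans ?_ hPr
      exact mul_le_mul_right (hper A R hA hR hAR) _
    exact (ENNReal.ofReal_le_iff_le_toReal ENNReal.coe_ne_top).1 h1
  have hle : r⁻¹ ≤ (D⁻¹).toNNReal * (C₁ / profile n K R).toNNReal := by
    rw [← NNReal.coe_le_coe]
    push_cast
    rw [Real.coe_toNNReal _ (by positivity), Real.coe_toNNReal _ (by positivity)]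
    refine (inv_anti₀ (by positivity) hr').trans (le_of_eq ?_)
    rw [hCdef]; field_simp
  have hD' : (D⁻¹).toNNReal ≤ 1 := by
    rw [Real.toNNReal_le_one]; exact inv_le_one_of_one_le₀ hD1
  calc volume A * N r⁻¹
      ≤ ENNReal.ofReal (R ^ n) * (ENNReal.ofReal D⁻¹ * ENNReal.ofReal (C₂ / R ^ n)) := by
        rw [hAR]
        gcongr
        exact (hN.mono hle).trans ((hN _ _ hD').trans (mul_le_mul_right (hprof R hR) _))
    _ = ENNReal.ofReal (C₂ / D) := by
        rw [← ENNReal.ofReal_mul (by positivity), ← ENNReal.ofReal_mul (by positivity)]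
        congr 1; field_simp
    _ ≤ 1 := by
        rw [← ENNReal.ofReal_one]
        exact ENNReal.ofReal_le_ofReal ((div_le_one hD0).2 (le_max_right _ _))

/-! ### Tents and sharpness -/

/-- In polar coordinates the integrand is y^{-b} on (0,1] and y^{-1-b} beyond, so 0 < b < 1 is what
both ends need. -/
lemma integrable_min_mul_rpow {n : ℕ} (hn : 1 ≤ n) {b : ℝ} (hb0 : 0 < b) (hb1 : b < 1) :
    Integrable (fun w : Rn n => min 1 ‖w‖ * ‖w‖ ^ (-((n : ℝ) + b))) := by
  have : Nonempty (Fin n) := ⟨⟨0, hn⟩⟩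
  rw [integrable_fun_norm_addHaar (volume : Measure (Rn n))
    (f := fun y : ℝ => min 1 y * y ^ (-((n : ℝ) + b)))]
  rw [finrank_euclideanSpace, Fintype.card_fin, ← Set.Ioc_union_Ioi_eq_Ioi zero_le_one]
  have hpow : ∀ y : ℝ, 0 < y → y ^ (n - 1) * y ^ (-((n : ℝ) + b)) = y ^ (-1 - b) := by
    intro y hy
    rw [← Real.rpow_natCast, ← Real.rpow_add hy]
    congr 1
    push_cast [Nat.cast_sub hn]; ring
  refine IntegrableOn.union ?_ ?_
  · have h := (intervalIntegral.intervalIntegrable_rpow' (a := 0) (b := 1)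
      (r := -b) (by linarith))
    rw [intervalIntegrable_iff_integrableOn_Ioc_of_le zero_le_one] at h
    refine h.congr_fun (fun y hy => ?_) measurableSet_Ioc
    simp only [smul_eq_mul, min_eq_right hy.2]
    rw [mul_left_comm, hpow y hy.1, ← Real.rpow_one_add' hy.1.le (by linarith)]
    congr 1; ring
  · have h := integrableOn_Ioi_rpow_of_lt (a := -1 - b) (by linarith) one_pos
    refine h.congr_fun (fun y hy => ?_) measurableSet_Ioi
    have hy1 : (1 : ℝ) < y := hy
    simp only [smul_eq_mul, min_eq_left hy1.le, one_mul]
    rw [hpow y (by linarith)]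

/-- The rescaled majorant of the integrand in the energy of a tent. -/
noncomputable def tentMajorant (n : ℕ) (e₁ e₂ : ℝ) (w : Rn n) : ℝ≥0∞ :=
  ENNReal.ofReal (min 1 ‖w‖ * max (‖w‖⁻¹ ^ e₁) (‖w‖⁻¹ ^ e₂))

lemma measurable_tentMajorant (n : ℕ) (e₁ e₂ : ℝ) : Measurable (tentMajorant n e₁ e₂) := by
  unfold tentMajorant
  fun_prop

lemma lintegral_tentMajorant_lt_top {n : ℕ} (hn : 1 ≤ n) {b₁ b₂ : ℝ} (hb₁ : 0 < b₁)
    (hb₁' : b₁ < 1) (hb₂ : 0 < b₂) (hb₂' : b₂ < 1) :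
    ∫⁻ w, tentMajorant n (n + b₁) (n + b₂) w < ⊤ := by
  have h := ((integrable_min_mul_rpow hn hb₁ hb₁').add
    (integrable_min_mul_rpow hn hb₂ hb₂')).lintegral_lt_top
  refine lt_of_le_of_lt (lintegral_mono fun w => ENNReal.ofReal_le_ofReal ?_) h
  simp only [Pi.add_apply, ← mul_add]
  have hinv : ∀ e : ℝ, ‖w‖⁻¹ ^ e = ‖w‖ ^ (-e) := fun e => by
    rw [Real.inv_rpow (norm_nonneg _), Real.rpow_neg (norm_nonneg _)]
  rw [hinv, hinv]
  have h1 : 0 ≤ ‖w‖ ^ (-((n : ℝ) + b₁)) := by positivity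
  have h2 : 0 ≤ ‖w‖ ^ (-((n : ℝ) + b₂)) := by positivity
  refine mul_le_mul_of_nonneg_left (max_le (by linarith) (by linarith)) ?_
  positivity

lemma lintegral_comp_inv_smul {n : ℕ} {g : Rn n → ℝ≥0∞} (hg : Measurable g) {R : ℝ}
    (hR : 0 < R) : ∫⁻ z, g (R⁻¹ • z) = ENNReal.ofReal (R ^ n) * ∫⁻ w, g w := by
  have h := lintegral_map (μ := (volume : Measure (Rn n))) hg (measurable_const_smul R⁻¹)
  rw [Measure.map_addHaar_smul _ (inv_ne_zero hR.ne'), lintegral_smul_measure] at h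
  rw [← h, finrank_euclideanSpace, Fintype.card_fin, inv_pow, inv_inv, abs_of_pos (by positivity),
    smul_eq_mul]

/-- The tent of height `1` over the ball of radius `R`. -/
noncomputable def tent (n : ℕ) (R : ℝ) (x : Rn n) : ℝ := max 0 (1 - ‖x‖ / R)

lemma measurable_tent (n : ℕ) (R : ℝ) : Measurable (tent n R) := by
  unfold tent
  fun_prop

lemma tent_nonneg {n : ℕ} (R : ℝ) (x : Rn n) : 0 ≤ tent n R x := le_max_left _ _

lemma tent_le_one {n : ℕ} {R : ℝ} (hR : 0 < R) (x : Rn n) : tent n R x ≤ 1 :=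
  max_le zero_le_one (by have : 0 ≤ ‖x‖ / R := by positivity
                         linarith)

lemma tent_eq_zero {n : ℕ} {R : ℝ} (hR : 0 < R) {x : Rn n} (hx : x ∉ Metric.ball (0 : Rn n) R) :
    tent n R x = 0 := by
  have : 1 ≤ ‖x‖ / R := (one_le_div hR).2 (by simpa using hx)
  exact max_eq_left (by linarith)

lemma abs_tent_sub_le {n : ℕ} {R : ℝ} (hR : 0 < R) (x y : Rn n) :
    |tent n R x - tent n R y| ≤ min 1 ‖R⁻¹ • (x - y)‖ := by
  refine le_min ?_ ?_
  · rw [abs_le]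
    have := tent_nonneg R x; have := tent_nonneg R y
    have := tent_le_one hR x; have := tent_le_one hR y
    constructor <;> linarith
  · refine (abs_max_sub_max_le_max 0 (1 - ‖x‖ / R) 0 (1 - ‖y‖ / R)).trans ?_
    rw [norm_smul, Real.norm_eq_abs, abs_of_pos (inv_pos.2 hR), sub_self, abs_zero,
      max_eq_right (abs_nonneg _)]
    have : 1 - ‖x‖ / R - (1 - ‖y‖ / R) = R⁻¹ * (‖y‖ - ‖x‖) := by ring
    rw [this, abs_mul, abs_of_pos (inv_pos.2 hR), norm_sub_rev]
    gcongr
    exact abs_norm_sub_norm_le y x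

/-- A pair contributes only if one of its points lies in the ball. Fixing that point and rescaling
the difference by R leaves R^n K(R) times the integral of `tentMajorant`; the ball supplies the
other R^n. -/
lemma PowerRegular.energy_tent_le {n : ℕ} (hn : 1 ≤ n) {K : ℝ → ℝ} {b₁ b₂ : ℝ}
    (hK : PowerRegular K (n + b₁) (n + b₂)) (hb₁ : 0 < b₁) (hb₁' : b₁ < 1) (hb₂ : 0 < b₂)
    (hb₂' : b₂ < 1) :
    ∃ D : ℝ, 0 < D ∧ ∀ R, 0 < R → energy K (tent n R) ≤ ENNReal.ofReal (D * profile n K R) := by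
  obtain ⟨C, hC, hb⟩ := hK.bound
  set ω := (volume (Metric.ball (0 : Rn n) 1)).toReal with hω
  have hω0 : 0 < ω := volume_ball_one_pos n
  have hJ := lintegral_tentMajorant_lt_top hn hb₁ hb₁' hb₂ hb₂'
  set g := tentMajorant n (n + b₁) (n + b₂) with hg
  have hgm : Measurable g := measurable_tentMajorant _ _ _
  set J := (∫⁻ w, g w).toReal with hJdef
  have hJ0 : 0 ≤ J := ENNReal.toReal_nonneg
  refine ⟨2 * ω * C * (J + 1), by positivity, fun R hR => ?_⟩
  have hKR := hK.pos R hR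
  set B := Metric.ball (0 : Rn n) R with hB
  have hBm : MeasurableSet B := measurableSet_ball
  set G : Rn n → ℝ≥0∞ := fun z => ENNReal.ofReal (C * K R) * g (R⁻¹ • z) with hG
  have hgs : Measurable fun z => g (R⁻¹ • z) := hgm.comp (measurable_const_smul R⁻¹)
  have hGm : Measurable G := hgs.const_mul _
  have hGint : ∫⁻ z, G z = ENNReal.ofReal (C * K R * R ^ n * J) := by
    simp only [hG]
    rw [lintegral_const_mul _ hgs, lintegral_comp_inv_smul hgm hR, ← ENNReal.ofReal_toReal hJ.ne, ← hJdef,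
      ← ENNReal.ofReal_mul (by positivity), ← ENNReal.ofReal_mul (by positivity)]
    ring_nf
  have hdiff : ∀ p : Rn n × Rn n,
      ENNReal.ofReal (|tent n R p.1 - tent n R p.2| * K ‖p.1 - p.2‖) ≤ G (p.1 - p.2) := by
    intro p
    simp only [hG, hg, tentMajorant]
    rw [← ENNReal.ofReal_mul (by positivity)]
    refine ENNReal.ofReal_le_ofReal ?_
    by_cases hp : p.1 = p.2
    · simp [hp]
    have hz : 0 < ‖p.1 - p.2‖ := by simpa [sub_eq_zero] using hp
    have hnorm : ‖R⁻¹ • (p.1 - p.2)‖⁻¹ = R / ‖p.1 - p.2‖ := by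
      rw [norm_smul, Real.norm_eq_abs, abs_of_pos (inv_pos.2 hR)]; field_simp
    rw [hnorm]
    have hKz := hK.pos _ hz
    calc _ ≤ min 1 ‖R⁻¹ • (p.1 - p.2)‖ * (C * K R *
          max ((R / ‖p.1 - p.2‖) ^ ((n : ℝ) + b₁)) ((R / ‖p.1 - p.2‖) ^ ((n : ℝ) + b₂))) := by
            gcongr
            · exact abs_tent_sub_le hR _ _
            · exact hb _ _ hz hR
      _ = _ := by ring
  have hpt : ∀ p : Rn n × Rn n,
      ENNReal.ofReal (|tent n R p.1 - tent n R p.2| * K ‖p.1 - p.2‖) ≤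
        B.indicator 1 p.1 * G (p.1 - p.2) + B.indicator 1 p.2 * G (p.1 - p.2) := by
    intro p
    by_cases h1 : p.1 ∈ B
    · refine (hdiff p).trans (le_trans ?_ le_self_add)
      simp [h1]
    by_cases h2 : p.2 ∈ B
    · refine (hdiff p).trans (le_trans ?_ le_add_self)
      simp [h2]
    simp [tent_eq_zero hR h1, tent_eq_zero hR h2]
  have hBi : Measurable (B.indicator (1 : Rn n → ℝ≥0∞)) := measurable_one.indicator hBm
  have hGd : Measurable fun p : Rn n × Rn n => G (p.1 - p.2) := hGm.comp (by fun_prop)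
  have hm₁ : Measurable fun p : Rn n × Rn n =>
      B.indicator (1 : Rn n → ℝ≥0∞) p.1 * G (p.1 - p.2) := (hBi.comp measurable_fst).mul hGd
  have hm₂ : Measurable fun p : Rn n × Rn n =>
      B.indicator (1 : Rn n → ℝ≥0∞) p.2 * G (p.1 - p.2) := (hBi.comp measurable_snd).mul hGd
  have hBvol : ∫⁻ x, B.indicator (1 : Rn n → ℝ≥0∞) x = ENNReal.ofReal (R ^ n * ω) := by
    rw [lintegral_indicator_one hBm, hB, volume_ball_eq _ hR]
  calc energy K (tent n R)
      ≤ ∫⁻ p : Rn n × Rn n,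
          (B.indicator 1 p.1 * G (p.1 - p.2) + B.indicator 1 p.2 * G (p.1 - p.2)) :=
        lintegral_mono hpt
    _ = (∫⁻ p : Rn n × Rn n, B.indicator 1 p.1 * G (p.1 - p.2)) +
          ∫⁻ p : Rn n × Rn n, B.indicator 1 p.2 * G (p.1 - p.2) :=
        lintegral_add_left hm₁ _
    _ = ENNReal.ofReal (R ^ n * ω) * (∫⁻ z, G z) +
          ENNReal.ofReal (R ^ n * ω) * (∫⁻ z, G z) := by
        rw [Measure.volume_eq_prod]
        congr 1
        · rw [lintegral_prod _ hm₁.aemeasurable, ← hBvol,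
            ← lintegral_mul_const _ hBi]
          refine lintegral_congr fun x => ?_
          have hx : Measurable fun y => G (x - y) := hGm.comp (measurable_const_sub x)
          refine (lintegral_const_mul (B.indicator 1 x) hx).trans ?_
          rw [lintegral_sub_left_eq_self G x]
        · rw [lintegral_prod_symm _ hm₂.aemeasurable, ← hBvol,
            ← lintegral_mul_const _ hBi]
          refine lintegral_congr fun y => ?_
          have hy : Measurable fun x => G (x - y) := hGm.comp (measurable_sub_const y)
          refine (lintegral_const_mul (B.indicator 1 y) hy).trans ?_
          rw [lintegral_sub_right_eq_self G y]
    _ = ENNReal.ofReal (2 * ω * C * J * profile n K R) := by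
        rw [hGint, ← ENNReal.ofReal_mul (by positivity),
          ← ENNReal.ofReal_add (by positivity) (by positivity), profile]
        congr 1; ring
    _ ≤ ENNReal.ofReal (2 * ω * C * (J + 1) * profile n K R) := by
        have := hK.profile_pos n hR
        refine ENNReal.ofReal_le_ofReal ?_
        gcongr
        linarith

lemma IsYoung.memOrlicz_tent {n : ℕ} {N : ℝ≥0 → ℝ≥0∞} (hN : IsYoung N) {R : ℝ} (hR : 0 < R) :
    MemOrlicz N (tent n R) := by
  refine ⟨measurable_tent n R, ?_⟩
  obtain ⟨s, hs, hNs⟩ := hN.finite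
  have hst := hN.starShaped
  set B := Metric.ball (0 : Rn n) R with hB
  have hM : volume B * N s ≠ ⊤ := ENNReal.mul_ne_top measure_ball_lt_top.ne hNs
  obtain ⟨m, hm⟩ : ∃ m : ℝ≥0, (m : ℝ≥0∞) = volume B * N s := ⟨_, ENNReal.coe_toNNReal hM⟩
  -- Shrinking the argument by a brings the integral, at most m before shrinking, below 1 by
  -- star-shapedness.
  set a : ℝ≥0 := (1 + m)⁻¹ with ha
  have ha0 : 0 < a := by positivity
  have ha1 : a ≤ 1 := inv_le_one_of_one_le₀ (by simp)
  have hint : ∫⁻ x, N (‖tent n R x‖₊ / (a * s)⁻¹) ≤ 1 := by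
    calc ∫⁻ x, N (‖tent n R x‖₊ / (a * s)⁻¹) ≤ ∫⁻ x, B.indicator (fun _ => N (a * s)) x := by
          refine lintegral_mono fun x => ?_
          by_cases hx : x ∈ B
          · rw [Set.indicator_of_mem hx]
            refine hN.mono ?_
            rw [div_inv_eq_mul]
            refine mul_le_of_le_one_left (zero_le) ?_
            rw [← NNReal.coe_le_coe, coe_nnnorm, Real.norm_of_nonneg (tent_nonneg R x)]
            exact tent_le_one hR x
          · simp [tent_eq_zero hR hx, hN.zero]
      _ = N (a * s) * volume B := lintegral_indicator_const measurableSet_ball _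
      _ ≤ a * N s * volume B := by gcongr; exact hst a s ha1
      _ = ((a * m : ℝ≥0) : ℝ≥0∞) := by rw [mul_assoc, mul_comm (N s), ← hm, ENNReal.coe_mul]
      _ ≤ 1 := by
          norm_cast
          rw [ha, inv_mul_le_iff₀ (by positivity)]
          simp
  exact lt_of_le_of_lt (iInf₂_le (a * s)⁻¹ ⟨by positivity, hint⟩) ENNReal.coe_lt_top

/-- If the inequality holds for a Young function `N`, tents bound `N` along the profile of `K`. -/
lemma IsYoung.le_of_orliczSobolev {n : ℕ} {N : ℝ≥0 → ℝ≥0∞} {K : ℝ → ℝ} {C D : ℝ}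
    (hN : IsYoung N) (hC : 0 < C) (hS : OrliczSobolev n N K C) {R : ℝ} (hR : 0 < R)
    (hp : 0 < D * profile n K R)
    (hE : energy K (tent n R) ≤ ENNReal.ofReal (D * profile n K R)) {s : ℝ≥0}
    (hs : 4 * C * D * s * profile n K R ≤ 1) :
    N s ≤ ENNReal.ofReal (2 ^ n / (volume (Metric.ball (0 : Rn n) 1)).toReal) *
      ENNReal.ofReal (1 / R ^ n) := by
  set ω := (volume (Metric.ball (0 : Rn n) 1)).toReal with hω
  have hω0 : 0 < ω := volume_ball_one_pos n
  have hQ : 0 < C * (D * profile n K R) := mul_pos hC hp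
  -- The infimum defining the norm need not be attained; the factor 2 makes the bound strict and so
  -- yields an admissible r. Another 2 is lost because the tent is at least 1/2 on the half ball,
  -- whence the 4 in the hypothesis.
  have hlt : orliczNorm N (tent n R) < ENNReal.ofReal (2 * (C * (D * profile n K R))) := by
    refine lt_of_le_of_lt ((hS _ (hN.memOrlicz_tent hR)).trans (mul_le_mul_right hE _)) ?_
    rw [← ENNReal.ofReal_mul hC.le]
    exact (ENNReal.ofReal_lt_ofReal_iff (by linarith)).2 (by linarith)
  obtain ⟨r, hr⟩ := iInf_lt_iff.1 hlt
  obtain ⟨⟨hr0, hr1⟩, hr2⟩ := iInf_lt_iff.1 hr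
  have hr3 : (r : ℝ) < 2 * (C * (D * profile n K R)) := by
    rw [← ENNReal.ofReal_coe_nnreal] at hr2
    exact (ENNReal.ofReal_lt_ofReal_iff (by linarith)).1 hr2
  set B := Metric.ball (0 : Rn n) (R / 2) with hB
  have hBvol : volume B = ENNReal.ofReal ((R / 2) ^ n * ω) := volume_ball_eq _ (by positivity)
  have hle : N s * volume B ≤ 1 := by
    rw [← lintegral_indicator_const measurableSet_ball]
    refine le_trans (lintegral_mono fun x => ?_) hr1
    by_cases hx : x ∈ B
    · rw [Set.indicator_of_mem hx]
      refine hN.mono ?_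
      rw [← NNReal.coe_le_coe, NNReal.coe_div, coe_nnnorm, Real.norm_of_nonneg (tent_nonneg R x),
        le_div_iff₀ (by exact_mod_cast hr0)]
      have h1 : (1 : ℝ) / 2 ≤ tent n R x := by
        have hx' : ‖x‖ < R / 2 := by simpa [hB] using hx
        have : ‖x‖ / R ≤ 1 / 2 := by rw [div_le_iff₀ hR]; linarith
        exact le_max_of_le_right (by linarith)
      have h2 : (s : ℝ) * r ≤ s * (2 * (C * (D * profile n K R))) := by gcongr
      linarith
    · rw [Set.indicator_of_notMem hx]
      exact zero_le
  have hB0 : volume B ≠ 0 := (Metric.measure_ball_pos _ _ (by positivity)).ne'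
  rw [← ENNReal.le_div_iff_mul_le (Or.inl hB0) (Or.inl measure_ball_lt_top.ne), hBvol] at hle
  refine hle.trans (le_of_eq ?_)
  rw [← ENNReal.ofReal_one, ← ENNReal.ofReal_div_of_pos (by positivity),
    ← ENNReal.ofReal_mul (by positivity)]
  congr 1
  rw [div_pow]; field_simp

theorem PowerRegular.sharp {n : ℕ} (hn : 1 ≤ n) {K : ℝ → ℝ} {b₁ b₂ : ℝ}
    (hK : PowerRegular K (n + b₁) (n + b₂)) (hb₁ : 0 < b₁) (hb₁' : b₁ < 1) (hb₂ : 0 < b₂)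
    (hb₂' : b₂ < 1) {N₀ : ℝ≥0 → ℝ≥0∞} (hN₀ : ∀ s, 0 < s → N₀ s ≠ 0 ∧ N₀ s ≠ ⊤)
    (hlow : ∀ B : ℝ, 0 < B → ∃ C : ℝ, ∀ s : ℝ≥0, 0 < s → ∃ R : ℝ, 0 < R ∧
      B * s * profile n K R ≤ 1 ∧ ENNReal.ofReal (1 / R ^ n) ≤ ENNReal.ofReal C * N₀ s) :
    Sharp n N₀ K := by
  rintro N hN hND ⟨C, hC, hS⟩
  obtain ⟨D, hD, hE⟩ := hK.energy_tent_le hn hb₁ hb₁' hb₂ hb₂'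
  obtain ⟨C', hC'⟩ := hlow (4 * C * D) (by positivity)
  have hbound : (⨆ (s : ℝ≥0) (_ : 0 < s), ratio (N s) (N₀ s)) ≤
      ENNReal.ofReal (2 ^ n / (volume (Metric.ball (0 : Rn n) 1)).toReal) *
        ENNReal.ofReal C' := by
    refine iSup₂_le fun s hs => ?_
    obtain ⟨R, hR, h1, h2⟩ := hC' s hs
    obtain ⟨h0, htop⟩ := hN₀ s hs
    rw [ratio, if_neg (by simp [h0, htop])]
    refine ENNReal.div_le_of_le_mul ?_
    rw [mul_assoc]
    exact (hN.le_of_orliczSobolev hC hS hR (mul_pos hD (hK.profile_pos n hR)) (hE R hR) h1).trans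
      (mul_le_mul_right h2 _)
  rw [NotDominated] at hND
  rw [hND] at hbound
  exact absurd hbound (not_le.2 (by finiteness))

/-! ### The function Φ_h and its inverse -/

section PhiFunction

variable {n : ℕ} {α : ℝ} {h : ℝ → ℝ}

/-- For r ≤ R use that h increases, for r ≥ R that s/h(s) does. The two exponents never both lie
strictly between n and n+1, so the tent estimate does not apply; for the perimeter bound
nonnegativity is enough. -/
lemma MemH.powerRegular (hh : MemH n α h) :
    PowerRegular (kerH n α h) (n + α) (n + α - 1) where
  pos r hr := div_pos (hh.pos r hr) (by positivity)
  bound := by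
    refine ⟨1, one_pos, fun r R hr hR => ?_⟩
    have hhr := hh.pos r hr
    have hhR := hh.pos R hR
    have hq : 0 < R / r := by positivity
    have hKR : kerH n α h R * (R / r) ^ ((n : ℝ) + α) = h R / r ^ ((n : ℝ) + α) := by
      rw [kerH, Real.div_rpow hR.le hr.le]; field_simp
    have hKR0 : 0 < kerH n α h R := div_pos hhR (by positivity)
    rw [one_mul]
    rcases le_total r R with hrR | hrR
    · refine le_trans ?_ (mul_le_mul_of_nonneg_left (le_max_left _ _) hKR0.le)
      rw [hKR, kerH]
      gcongr
      exact hh.mono hr hR hrR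
    · refine le_trans ?_ (mul_le_mul_of_nonneg_left (le_max_right _ _) hKR0.le)
      rw [Real.rpow_sub_one hq.ne', ← mul_div_assoc, hKR, kerH, le_div_iff₀ hq]
      have h1 : R / h R ≤ r / h r := hh.mono_div hR hr hrR
      rw [div_le_div_iff₀ hhR hhr] at h1
      rw [div_mul_eq_mul_div]
      gcongr
      rw [mul_div_assoc', div_le_iff₀ hr]
      linarith

lemma MemH.measurable_indicator (hh : MemH n α h) :
    Measurable ((Set.Ioi 0).indicator (kerH n α h)) := by
  have hmono : Monotone ((Set.Ioi 0).indicator h) := by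
    intro x y hxy
    by_cases hx : 0 < x
    · have hy : 0 < y := hx.trans_le hxy
      simpa [hx, hy] using hh.mono hx hy hxy
    · rw [Set.indicator_of_notMem (by simpa using hx)]
      exact Set.indicator_nonneg (fun s hs => (hh.pos s hs).le) y
  have heq : (Set.Ioi 0).indicator (kerH n α h) =
      fun r => (Set.Ioi 0).indicator h r / r ^ ((n : ℝ) + α) := by
    ext r
    by_cases hr : 0 < r
    · simp [hr, kerH]
    · simp [hr]
  rw [heq]
  exact hmono.measurable.div (by fun_prop)

/-- The inner integral in the definition of `Phi`. -/
noncomputable def phi (n : ℕ) (α : ℝ) (h : ℝ → ℝ) (t : ℝ) : ℝ≥0∞ :=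
  ∫⁻ r in Set.Ioc (0 : ℝ) (t ^ (-(1 / (n : ℝ)))), ENNReal.ofReal (r ^ (α - 1) / h r)

lemma phi_anti {s t : ℝ} (hs : 0 < s) (hst : s ≤ t) : phi n α h t ≤ phi n α h s := by
  refine lintegral_mono_set (Set.Ioc_subset_Ioc_right ?_)
  exact Real.rpow_le_rpow_of_nonpos hs hst (by rw [neg_nonpos]; positivity)

lemma mul_phi_le_Phi (t : ℝ≥0) : t * phi n α h t ≤ Phi n α h t := by
  have h1 : ∫⁻ _ in Set.Ioc (0 : ℝ) t, phi n α h t ≤ Phi n α h t :=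
    setLIntegral_mono' measurableSet_Ioc fun r hr => phi_anti hr.1 hr.2
  rw [setLIntegral_const, Real.volume_Ioc, sub_zero, ENNReal.ofReal_coe_nnreal, mul_comm] at h1
  exact h1

lemma Phi_mono : Monotone (Phi n α h) := fun _ _ hst =>
  lintegral_mono_set (Set.Ioc_subset_Ioc_right (by exact_mod_cast hst))

/-- `Phi` is concave with `Phi 0 = 0`; this is the part of it that is used. -/
lemma mul_Phi_le {a : ℝ≥0} (ha : a ≤ 1) (t : ℝ≥0) : a * Phi n α h t ≤ Phi n α h (a * t) := by
  rcases eq_or_ne (a * t) 0 with h0 | h0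
  · rcases mul_eq_zero.1 h0 with rfl | rfl
    · simp
    · simp [Phi]
  have hat : 0 < a * t := pos_iff_ne_zero.2 h0
  have hle : a * t ≤ t := mul_le_of_le_one_left (zero_le) ha
  set p := phi n α h (a * t : ℝ≥0) with hp
  -- The density `phi` decreases: beyond a t it is at most its value p at a t, while a t p is at
  -- most Phi(a t).
  have h1 : Phi n α h t ≤ Phi n α h (a * t) + ((1 - a) * t : ℝ≥0) * p := by
    have hsub : Set.Ioc (0 : ℝ) t =
        Set.Ioc (0 : ℝ) (a * t : ℝ≥0) ∪ Set.Ioc ((a * t : ℝ≥0) : ℝ) t :=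
      (Set.Ioc_union_Ioc_eq_Ioc (NNReal.coe_nonneg _) (by exact_mod_cast hle)).symm
    rw [Phi, hsub]
    refine (lintegral_union_le _ _ _).trans (add_le_add le_rfl ?_)
    have h2 : ∫⁻ r in Set.Ioc ((a * t : ℝ≥0) : ℝ) t, phi n α h r ≤
        ∫⁻ _ in Set.Ioc ((a * t : ℝ≥0) : ℝ) t, p :=
      setLIntegral_mono' measurableSet_Ioc fun r hr => phi_anti (by exact_mod_cast hat) hr.1.le
    refine h2.trans (le_of_eq ?_)
    rw [setLIntegral_const, Real.volume_Ioc, mul_comm]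
    congr 1
    rw [← ENNReal.ofReal_coe_nnreal]
    congr 1
    push_cast [NNReal.coe_sub ha]
    ring
  have h3 := mul_phi_le_Phi (n := n) (α := α) (h := h) (a * t)
  calc (a : ℝ≥0∞) * Phi n α h t
      ≤ a * (Phi n α h (a * t) + ((1 - a) * t : ℝ≥0) * p) := by gcongr
    _ = a * Phi n α h (a * t) + ((1 - a : ℝ≥0) : ℝ≥0∞) * ((a * t : ℝ≥0) * p) := by
        push_cast; ring
    _ ≤ a * Phi n α h (a * t) + ((1 - a : ℝ≥0) : ℝ≥0∞) * Phi n α h (a * t) := by gcongr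
    _ = Phi n α h (a * t) := by
        rw [← add_mul, ← ENNReal.coe_add, add_tsub_cancel_of_le ha]; simp

/-- Φ_h(t) is at least t times its density at t. For t = R^{-n} the density is an integral over (0,
R], whose upper half alone contributes a multiple of R^α / h(R), since h increases. -/
lemma MemH.Phi_ge (hn : 1 ≤ n) (hα : 0 < α) (hh : MemH n α h) {R : ℝ} (hR : 0 < R) :
    ENNReal.ofReal ((1 / 2) ^ α / 2 / profile n (kerH n α h) R) ≤
      Phi n α h (1 / R ^ n).toNNReal := by
  have hhR := hh.pos R hR
  have ht : 0 < 1 / R ^ n := by positivity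
  have hroot : (1 / R ^ n) ^ (-(1 / (n : ℝ))) = R := by
    rw [one_div, Real.inv_rpow (by positivity), Real.rpow_neg (by positivity), inv_inv, one_div]
    exact Real.pow_rpow_inv_natCast hR.le (by omega)
  have hphi : ENNReal.ofReal ((1 / 2) ^ α / 2 * (R ^ α / h R)) ≤ phi n α h (1 / R ^ n) := by
    rw [phi, hroot]
    have h1 : ∫⁻ _ in Set.Ioc (R / 2) R, ENNReal.ofReal ((R / 2) ^ α / R / h R) ≤
        ∫⁻ r in Set.Ioc (R / 2) R, ENNReal.ofReal (r ^ (α - 1) / h r) := by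
      refine setLIntegral_mono' measurableSet_Ioc fun r hr => ENNReal.ofReal_le_ofReal ?_
      have hr0 : 0 < r := lt_trans (by positivity) hr.1
      rw [Real.rpow_sub_one hr0.ne']
      have := hh.pos r hr0
      gcongr
      · exact hr.1.le
      · exact hr.2
      · exact hh.mono hr0 hR hr.2
    refine le_trans (le_of_eq ?_)
      (h1.trans (lintegral_mono_set (Set.Ioc_subset_Ioc_left (by positivity))))
    rw [setLIntegral_const, Real.volume_Ioc, ← ENNReal.ofReal_mul (by positivity)]
    congr 1
    rw [show R / 2 = R * (1 / 2) by ring, Real.mul_rpow hR.le (by norm_num)]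
    field_simp
    ring
  refine le_trans ?_ (mul_phi_le_Phi _)
  rw [Real.coe_toNNReal _ ht.le]
  refine le_trans ?_ (mul_le_mul_right hphi _)
  change _ ≤ ENNReal.ofReal (1 / R ^ n) * _
  rw [← ENNReal.ofReal_mul ht.le]
  refine ENNReal.ofReal_le_ofReal (le_of_eq ?_)
  rw [profile, kerH, Real.rpow_add hR, Real.rpow_natCast]
  field_simp
  ring

lemma Nh_starShaped : StarShaped (Nh n α h) := by
  intro a u ha
  rcases eq_or_ne a 0 with rfl | ha0
  · rw [zero_mul, ENNReal.coe_zero, zero_mul, nonpos_iff_eq_zero]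
    refine le_antisymm (ENNReal.le_of_forall_pos_le_add fun ε hε _ => ?_) (zero_le)
    rw [zero_add]
    exact iInf₂_le ε ⟨hε, by simp⟩
  have ha' : 0 < a := pos_iff_ne_zero.2 ha0
  have hatop : (a : ℝ≥0∞) ≠ ⊤ := ENNReal.coe_ne_top
  rw [Nh, Nh, genInv, genInv, ENNReal.mul_iInf_of_ne (by simpa using ha0) hatop]
  refine le_iInf fun t => ?_
  rw [ENNReal.mul_iInf_of_ne (by simpa using ha0) hatop]
  refine le_iInf fun ht => ?_
  rw [← ENNReal.coe_mul]
  refine iInf₂_le (a * t) ⟨mul_pos ha' ht.1, ?_⟩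
  rw [ENNReal.coe_mul]
  exact (mul_le_mul_right ht.2 _).trans (mul_Phi_le ha t)

/-- Finiteness of Φ_h(1) and absolute continuity of the integral make Φ_h small near 0, so reaching
the level s takes a definite time. -/
lemma MemH.Nh_pos (hh : MemH n α h) {s : ℝ≥0} (hs : 0 < s) : 0 < Nh n α h s := by
  have hfin : ∫⁻ t, phi n α h t ∂(volume.restrict (Set.Ioc (0 : ℝ) ((1 : ℝ≥0) : ℝ))) ≠ ⊤ :=
    (hh.finite 1 one_pos).ne
  obtain ⟨δ, hδ, hδs⟩ := exists_pos_setLIntegral_lt_of_measure_lt hfin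
    (ε := s) (by simpa using hs.ne')
  obtain ⟨ε, hε0, hε1, hεδ⟩ : ∃ ε : ℝ≥0, 0 < ε ∧ ε ≤ 1 ∧ (ε : ℝ≥0∞) < δ := by
    obtain ⟨ε, hε0, hεδ⟩ := ENNReal.lt_iff_exists_nnreal_btwn.1 hδ
    exact ⟨min ε 1, lt_min (by simpa using hε0) one_pos, min_le_right _ _,
      lt_of_le_of_lt (by exact_mod_cast min_le_left _ _) hεδ⟩
  have hsub : Set.Ioc (0 : ℝ) ε ⊆ Set.Ioc (0 : ℝ) ((1 : ℝ≥0) : ℝ) :=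
    Set.Ioc_subset_Ioc_right (by exact_mod_cast hε1)
  have hlt : Phi n α h ε < s := by
    have h1 := hδs (Set.Ioc (0 : ℝ) ε) (by
      refine lt_of_le_of_lt (Measure.restrict_apply_le _ _) ?_
      rw [Real.volume_Ioc, sub_zero, ENNReal.ofReal_coe_nnreal]
      exact hεδ)
    rwa [Measure.restrict_restrict measurableSet_Ioc, Set.inter_eq_left.2 hsub] at h1
  refine lt_of_lt_of_le (ENNReal.coe_pos.2 hε0) (le_iInf₂ fun t ht => ?_)
  by_contra hlt'
  have htε : t ≤ ε := by exact_mod_cast (not_le.1 hlt').le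
  exact absurd (ht.2.trans (Phi_mono htε)) (not_le.2 hlt)

theorem MemH.exists_orliczSobolev (hn : 1 ≤ n) (hα : 0 < α) (hh : MemH n α h) :
    ∃ C : ℝ, 0 < C ∧ OrliczSobolev n (Nh n α h) (kerH n α h) C := by
  have hn' : (1 : ℝ) ≤ n := by exact_mod_cast hn
  refine hh.powerRegular.exists_orliczSobolev hn (by positivity) (by linarith)
    hh.measurable_indicator Nh_starShaped (fun s hs => hh.Nh_pos hs)
    (C₁ := (1 / 2) ^ α / 2) (C₂ := 1) (by positivity) fun R hR => ?_
  exact iInf₂_le (1 / R ^ n).toNNReal ⟨Real.toNNReal_pos.2 (by positivity), hh.Phi_ge hn hα hR⟩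

theorem MemH.iInf_perimeter_pos (hn : 1 ≤ n) (hα : 0 < α) (hh : MemH n α h) :
    0 < ⨅ (A : Set (Rn n)) (_ : MeasurableSet A ∧ 0 < volume A ∧ volume A < ⊤),
      genInv (Nh n α h) (volume A)⁻¹ * perimeter (kerH n α h) A := by
  have hn' : (1 : ℝ) ≤ n := by exact_mod_cast hn
  obtain ⟨c, hc, hper⟩ := hh.powerRegular.perimeter_ge hn (by positivity) (by linarith)
  set d : ℝ := (1 / 2) ^ α / 2 with hd
  have hd0 : 0 < d := by positivity
  refine lt_of_lt_of_le (ENNReal.ofReal_pos.2 (show 0 < 1 / 2 * d * c by positivity))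
    (le_iInf₂ fun A hA => ?_)
  obtain ⟨hAm, hA0, hA1⟩ := hA
  obtain ⟨R, hR, hAR⟩ := exists_radius hn hA0 hA1
  have hp := hh.powerRegular.profile_pos n hR
  -- The 1/2 creates a strict gap. For s below this bound, concavity gives s ≤ Φ_h(τ/2), so N_h(s) ≤
  -- τ/2 < τ, and s cannot compete in the infimum.
  have hgen : ENNReal.ofReal (1 / 2 * (d / profile n (kerH n α h) R)) ≤
      genInv (Nh n α h) (volume A)⁻¹ := by
    refine le_iInf₂ fun s hs => ?_
    by_contra hlt
    set τ : ℝ≥0 := (1 / R ^ n).toNNReal with hτ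
    have hτ0 : 0 < τ := Real.toNNReal_pos.2 (by positivity)
    have hsτ : (s : ℝ≥0∞) ≤ Phi n α h (2⁻¹ * τ) := by
      refine (not_le.1 hlt).le.trans (le_trans ?_ (mul_Phi_le (a := 2⁻¹) (by norm_num) τ))
      rw [ENNReal.ofReal_mul (by norm_num)]
      refine mul_le_mul' (le_of_eq ?_) (hh.Phi_ge hn hα hR)
      rw [one_div, ENNReal.ofReal_inv_of_pos two_pos]
      simp
    have hN : Nh n α h s ≤ (2⁻¹ * τ : ℝ≥0) := iInf₂_le (2⁻¹ * τ) ⟨by positivity, hsτ⟩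
    have hv : (volume A)⁻¹ = τ := by
      rw [hAR, ← ENNReal.ofReal_inv_of_pos (by positivity), hτ, one_div]; rfl
    have h1 := hs.2.trans hN
    rw [hv] at h1
    have h2 : (τ : ℝ) ≤ 2⁻¹ * τ := by exact_mod_cast h1
    have h3 : (0 : ℝ) < τ := by exact_mod_cast hτ0
    linarith
  refine le_trans (le_of_eq ?_) (mul_le_mul' hgen (hper A R hAm hR hAR))
  rw [← ENNReal.ofReal_mul (by positivity)]
  congr 1; field_simp

end PhiFunction

/-! ### Minima and maxima of two powers -/

section Powers

variable {n : ℕ} {α α₁ α₂ : ℝ}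

lemma sub_half_pos (hn : 1 ≤ n) (hα : α < 2) : 0 < (n : ℝ) - α / 2 := by
  have hn' : (1 : ℝ) ≤ n := by exact_mod_cast hn
  linarith

lemma one_lt_expo (hn : 1 ≤ n) (hα : 0 < α) (hα' : α < 2) : 1 < expo n α := by
  rw [expo, one_lt_div (sub_half_pos hn hα')]
  linarith

lemma powerRegular_one_div_max (x y : ℝ) :
    PowerRegular (fun r => 1 / max (r ^ x) (r ^ y)) x y where
  pos r hr := one_div_pos.2 (lt_max_of_lt_left (by positivity))
  bound := by
    refine ⟨1, one_pos, fun r R hr hR => ?_⟩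
    have h1 : 0 < max (r ^ x) (r ^ y) := lt_max_of_lt_left (by positivity)
    have h2 : 0 < max (R ^ x) (R ^ y) := lt_max_of_lt_left (by positivity)
    have hz : ∀ z : ℝ, R ^ z = (R / r) ^ z * r ^ z := fun z => by
      rw [← Real.mul_rpow (by positivity) hr.le, div_mul_cancel₀ _ hr.ne']
    rw [one_mul, div_mul_eq_mul_div, one_mul, div_le_div_iff₀ h1 h2, one_mul]
    refine max_le ?_ ?_
    · rw [hz x]; gcongr <;> exact le_max_left _ _
    · rw [hz y]; gcongr <;> exact le_max_right _ _

lemma powerRegular_one_div_min (x y : ℝ) :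
    PowerRegular (fun r => 1 / min (r ^ x) (r ^ y)) x y where
  pos r hr := one_div_pos.2 (lt_min (by positivity) (by positivity))
  bound := by
    refine ⟨1, one_pos, fun r R hr hR => ?_⟩
    have h1 : 0 < min (r ^ x) (r ^ y) := lt_min (by positivity) (by positivity)
    have h2 : 0 < min (R ^ x) (R ^ y) := lt_min (by positivity) (by positivity)
    have hz : ∀ z : ℝ, R ^ z = (R / r) ^ z * r ^ z := fun z => by
      rw [← Real.mul_rpow (by positivity) hr.le, div_mul_cancel₀ _ hr.ne']
    rw [one_mul, div_mul_eq_mul_div, one_mul, div_le_div_iff₀ h1 h2, one_mul]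
    rcases min_choice (r ^ x) (r ^ y) with h | h <;> rw [h]
    · refine (min_le_left _ _).trans ?_
      rw [hz x]; gcongr; exact le_max_left _ _
    · refine (min_le_right _ _).trans ?_
      rw [hz y]; gcongr; exact le_max_right _ _

lemma rpow_mul_le {e : ℝ} (he : 1 ≤ e) {a : ℝ≥0} (ha : a ≤ 1) (u : ℝ≥0) :
    (a * u) ^ e ≤ a * u ^ e := by
  rw [NNReal.mul_rpow]
  gcongr
  exact NNReal.rpow_le_self_of_le_one ha he

lemma Nmin_starShaped (h₁ : 1 ≤ expo n α₁) (h₂ : 1 ≤ expo n α₂) :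
    StarShaped (Nmin n α₁ α₂) := by
  intro a u ha
  rw [Nmin, Nmin, ← ENNReal.coe_mul, ENNReal.coe_le_coe, mul_min]
  exact min_le_min (rpow_mul_le h₁ ha u) (rpow_mul_le h₂ ha u)

lemma Nmax_starShaped (h₁ : 1 ≤ expo n α₁) (h₂ : 1 ≤ expo n α₂) :
    StarShaped (Nmax n α₁ α₂) := by
  intro a u ha
  rw [Nmax, Nmax, ← ENNReal.coe_mul, ENNReal.coe_le_coe, mul_max]
  exact max_le_max (rpow_mul_le h₁ ha u) (rpow_mul_le h₂ ha u)

lemma Nmin_eq_ofReal (s : ℝ≥0) : Nmin n α₁ α₂ s =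
    ENNReal.ofReal (min ((s : ℝ) ^ expo n α₁) ((s : ℝ) ^ expo n α₂)) := by
  rw [Nmin, ← ENNReal.ofReal_coe_nnreal]; push_cast; rfl

lemma Nmax_eq_ofReal (s : ℝ≥0) : Nmax n α₁ α₂ s =
    ENNReal.ofReal (max ((s : ℝ) ^ expo n α₁) ((s : ℝ) ^ expo n α₂)) := by
  rw [Nmax, ← ENNReal.ofReal_coe_nnreal]; push_cast; rfl

lemma rpow_inv_expo_mul (hn : 1 ≤ n) {R : ℝ} (hR : 0 < R) :
    (1 / R ^ n) ^ (expo n α)⁻¹ * R ^ (2 * n) = R ^ ((n : ℝ) + α / 2) := by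
  have hn0 : (n : ℝ) ≠ 0 := by positivity
  rw [expo, inv_div, one_div, ← Real.rpow_natCast, ← Real.rpow_neg hR.le, ← Real.rpow_mul hR.le,
    ← Real.rpow_natCast, ← Real.rpow_add hR]
  congr 1
  push_cast
  field_simp
  ring

/-- The right side is the inverse function of `Nmin` at R^{-n}: the inverse of a minimum of
increasing functions is the maximum of their inverses. -/
lemma one_div_profile_kerMax (hn : 1 ≤ n) {R : ℝ} (hR : 0 < R) :
    1 / profile n (kerMax n α₁ α₂) R =
      max ((1 / R ^ n) ^ (expo n α₁)⁻¹) ((1 / R ^ n) ^ (expo n α₂)⁻¹) := by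
  rw [profile, kerMax, ← rpow_inv_expo_mul (α := α₁) hn hR, ← rpow_inv_expo_mul (α := α₂) hn hR,
    ← max_mul_of_nonneg _ _ (by positivity)]
  have : 0 < max ((1 / R ^ n) ^ (expo n α₁)⁻¹) ((1 / R ^ n) ^ (expo n α₂)⁻¹) :=
    lt_max_of_lt_left (by positivity)
  field_simp

lemma one_div_profile_kerMin (hn : 1 ≤ n) {R : ℝ} (hR : 0 < R) :
    1 / profile n (kerMin n α₁ α₂) R =
      min ((1 / R ^ n) ^ (expo n α₁)⁻¹) ((1 / R ^ n) ^ (expo n α₂)⁻¹) := by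
  rw [profile, kerMin, ← rpow_inv_expo_mul (α := α₁) hn hR, ← rpow_inv_expo_mul (α := α₂) hn hR,
    ← min_mul_of_nonneg _ _ (by positivity)]
  have : 0 < min ((1 / R ^ n) ^ (expo n α₁)⁻¹) ((1 / R ^ n) ^ (expo n α₂)⁻¹) :=
    lt_min (by positivity) (by positivity)
  field_simp

lemma exists_one_div_pow_eq (hn : 1 ≤ n) {m : ℝ} (hm : 0 < m) :
    ∃ R : ℝ, 0 < R ∧ 1 / R ^ n = m := by
  refine ⟨m⁻¹ ^ ((n : ℝ)⁻¹), by positivity, ?_⟩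
  rw [Real.rpow_inv_natCast_pow (by positivity) (by omega), one_div, inv_inv]

lemma kerMax_powerRegular (n : ℕ) (α₁ α₂ : ℝ) :
    PowerRegular (kerMax n α₁ α₂) (n + α₁ / 2) (n + α₂ / 2) := powerRegular_one_div_max _ _

lemma kerMin_powerRegular (n : ℕ) (α₁ α₂ : ℝ) :
    PowerRegular (kerMin n α₁ α₂) (n + α₁ / 2) (n + α₂ / 2) := powerRegular_one_div_min _ _

theorem exists_orliczSobolev_Nmin (hn : 1 ≤ n) (h₁ : 0 < α₁) (h₁' : α₁ < 2) (h₂ : 0 < α₂)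
    (h₂' : α₂ < 2) : ∃ C : ℝ, 0 < C ∧ OrliczSobolev n (Nmin n α₁ α₂) (kerMax n α₁ α₂) C := by
  have he₁ := one_lt_expo hn h₁ h₁'
  have he₂ := one_lt_expo hn h₂ h₂'
  refine (kerMax_powerRegular n α₁ α₂).exists_orliczSobolev hn (by positivity) (by positivity)
    (Measurable.indicator (by unfold kerMax; fun_prop) measurableSet_Ioi)
    (Nmin_starShaped he₁.le he₂.le) (fun s hs => ?_) (C₁ := 1) (C₂ := 1) one_pos fun R hR => ?_
  · rw [Nmin, ENNReal.coe_pos]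
    exact lt_min (NNReal.rpow_pos hs) (NNReal.rpow_pos hs)
  · have hp := (kerMax_powerRegular n α₁ α₂).profile_pos n hR
    rw [Nmin_eq_ofReal, Real.coe_toNNReal _ (by positivity), one_div_profile_kerMax hn hR]
    refine ENNReal.ofReal_le_ofReal ?_
    have hm : 0 ≤ 1 / R ^ n := by positivity
    rcases max_choice ((1 / R ^ n) ^ (expo n α₁)⁻¹) ((1 / R ^ n) ^ (expo n α₂)⁻¹) with h | h <;>
      rw [h]
    · exact (min_le_left _ _).trans_eq (Real.rpow_inv_rpow hm (by linarith))
    · exact (min_le_right _ _).trans_eq (Real.rpow_inv_rpow hm (by linarith))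

theorem exists_orliczSobolev_Nmax (hn : 1 ≤ n) (h₁ : 0 < α₁) (h₁' : α₁ < 2) (h₂ : 0 < α₂)
    (h₂' : α₂ < 2) : ∃ C : ℝ, 0 < C ∧ OrliczSobolev n (Nmax n α₁ α₂) (kerMin n α₁ α₂) C := by
  have he₁ := one_lt_expo hn h₁ h₁'
  have he₂ := one_lt_expo hn h₂ h₂'
  refine (kerMin_powerRegular n α₁ α₂).exists_orliczSobolev hn (by positivity) (by positivity)
    (Measurable.indicator (by unfold kerMin; fun_prop) measurableSet_Ioi)
    (Nmax_starShaped he₁.le he₂.le) (fun s hs => ?_) (C₁ := 1) (C₂ := 1) one_pos fun R hR => ?_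
  · rw [Nmax, ENNReal.coe_pos]
    exact lt_max_of_lt_left (NNReal.rpow_pos hs)
  · have hp := (kerMin_powerRegular n α₁ α₂).profile_pos n hR
    rw [Nmax_eq_ofReal, Real.coe_toNNReal _ (by positivity), one_div_profile_kerMin hn hR]
    refine ENNReal.ofReal_le_ofReal (max_le ?_ ?_)
    · refine le_trans (Real.rpow_le_rpow (by positivity) (min_le_left _ _) (by linarith)) ?_
      exact (Real.rpow_inv_rpow (by positivity) (by linarith)).le
    · refine le_trans (Real.rpow_le_rpow (by positivity) (min_le_right _ _) (by linarith)) ?_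
      exact (Real.rpow_inv_rpow (by positivity) (by linarith)).le

theorem sharp_Nmin (hn : 1 ≤ n) (h₁ : 0 < α₁) (h₁' : α₁ < 2) (h₂ : 0 < α₂) (h₂' : α₂ < 2) :
    Sharp n (Nmin n α₁ α₂) (kerMax n α₁ α₂) := by
  have he₁ := one_lt_expo hn h₁ h₁'
  have he₂ := one_lt_expo hn h₂ h₂'
  refine (kerMax_powerRegular n α₁ α₂).sharp hn (by linarith) (by linarith) (by linarith)
    (by linarith) (fun s hs => ⟨?_, ENNReal.coe_ne_top⟩) fun B hB =>
      ⟨max (B ^ expo n α₁) (B ^ expo n α₂), fun s hs => ?_⟩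
  · rw [Nmin, ENNReal.coe_ne_zero]
    exact (lt_min (NNReal.rpow_pos hs) (NNReal.rpow_pos hs)).ne'
  have hs' : (0 : ℝ) < s := by exact_mod_cast hs
  have hy : 0 < B * s := by positivity
  -- R solves R^{-n} = `Nmin`(Bs), so that Bs is at most 1/profile(R).
  obtain ⟨R, hR, hRm⟩ := exists_one_div_pow_eq hn
    (lt_min (Real.rpow_pos_of_pos hy (expo n α₁)) (Real.rpow_pos_of_pos hy (expo n α₂)))
  refine ⟨R, hR, ?_, ?_⟩
  · rw [← le_div_iff₀ ((kerMax_powerRegular n α₁ α₂).profile_pos n hR),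
      one_div_profile_kerMax hn hR, hRm]
    rcases min_choice ((B * s) ^ expo n α₁) ((B * s) ^ expo n α₂) with h | h <;> rw [h]
    · exact le_max_of_le_left (Real.rpow_rpow_inv hy.le (by linarith)).ge
    · exact le_max_of_le_right (Real.rpow_rpow_inv hy.le (by linarith)).ge
  · have hC : 0 < max (B ^ expo n α₁) (B ^ expo n α₂) := lt_max_of_lt_left (by positivity)
    rw [hRm, Nmin_eq_ofReal, ← ENNReal.ofReal_mul hC.le, mul_min_of_nonneg _ _ hC.le,
      Real.mul_rpow hB.le hs'.le, Real.mul_rpow hB.le hs'.le]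
    refine ENNReal.ofReal_le_ofReal (min_le_min ?_ ?_)
    · gcongr; exact le_max_left _ _
    · gcongr; exact le_max_right _ _

theorem sharp_Nmax (hn : 1 ≤ n) (h₁ : 0 < α₁) (h₁' : α₁ < 2) (h₂ : 0 < α₂) (h₂' : α₂ < 2) :
    Sharp n (Nmax n α₁ α₂) (kerMin n α₁ α₂) := by
  have he₁ := one_lt_expo hn h₁ h₁'
  have he₂ := one_lt_expo hn h₂ h₂'
  refine (kerMin_powerRegular n α₁ α₂).sharp hn (by linarith) (by linarith) (by linarith)
    (by linarith) (fun s hs => ⟨?_, ENNReal.coe_ne_top⟩) fun B hB =>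
      ⟨max (B ^ expo n α₁) (B ^ expo n α₂), fun s hs => ?_⟩
  · rw [Nmax, ENNReal.coe_ne_zero]
    exact (lt_max_of_lt_left (NNReal.rpow_pos hs)).ne'
  have hs' : (0 : ℝ) < s := by exact_mod_cast hs
  have hy : 0 < B * s := by positivity
  obtain ⟨R, hR, hRm⟩ := exists_one_div_pow_eq hn
    (lt_max_of_lt_left (b := (B * s) ^ expo n α₁) (c := (B * s) ^ expo n α₂)
      (Real.rpow_pos_of_pos hy (expo n α₁)))
  refine ⟨R, hR, ?_, ?_⟩
  · rw [← le_div_iff₀ ((kerMin_powerRegular n α₁ α₂).profile_pos n hR),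
      one_div_profile_kerMin hn hR, hRm]
    refine le_min ?_ ?_
    · rw [← Real.rpow_rpow_inv hy.le (show expo n α₁ ≠ 0 by linarith)]
      exact Real.rpow_le_rpow (by positivity)
        (by rw [Real.rpow_rpow_inv hy.le (by linarith)]; exact le_max_left _ _) (by positivity)
    · rw [← Real.rpow_rpow_inv hy.le (show expo n α₂ ≠ 0 by linarith)]
      exact Real.rpow_le_rpow (by positivity)
        (by rw [Real.rpow_rpow_inv hy.le (by linarith)]; exact le_max_right _ _) (by positivity)
  · have hC : 0 < max (B ^ expo n α₁) (B ^ expo n α₂) := lt_max_of_lt_left (by positivity)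
    rw [hRm, Nmax_eq_ofReal, ← ENNReal.ofReal_mul hC.le, mul_max_of_nonneg _ _ hC.le,
      Real.mul_rpow hB.le hs'.le, Real.mul_rpow hB.le hs'.le]
    refine ENNReal.ofReal_le_ofReal (max_le_max ?_ ?_)
    · gcongr; exact le_max_left _ _
    · gcongr; exact le_max_right _ _

end Powers

/-! ### Slow variation of the logarithm -/

section LogComparison

/-- `u` and `v` agree up to the factor `A`. -/
def Comparable (A u v : ℝ) : Prop := u ≤ A * v ∧ v ≤ A * u

lemma Comparable.symm {A u v : ℝ} (h : Comparable A u v) : Comparable A v u := ⟨h.2, h.1⟩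

lemma Comparable.trans {A A' u v w : ℝ} (hA : 0 ≤ A) (hA' : 0 ≤ A') (h : Comparable A u v)
    (h' : Comparable A' v w) : Comparable (A * A') u w := by
  refine ⟨h.1.trans ?_, h'.2.trans ?_⟩
  · rw [mul_assoc]; exact mul_le_mul_of_nonneg_left h'.1 hA
  · rw [mul_comm A, mul_assoc]; exact mul_le_mul_of_nonneg_left h.2 hA'

/-- The two-sided comparison is needed because q may be negative; this is why all logarithmic
estimates are kept two-sided. -/
lemma Comparable.rpow_le {A u v : ℝ} (hA : 0 < A) (hu : 0 < u) (hv : 0 < v)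
    (h : Comparable A u v) (q : ℝ) : u ^ q ≤ A ^ |q| * v ^ q := by
  rcases le_total 0 q with hq | hq
  · rw [abs_of_nonneg hq, ← Real.mul_rpow hA.le hv.le]
    exact Real.rpow_le_rpow hu.le h.1 hq
  · rw [abs_of_nonpos hq, Real.rpow_neg hA.le, ← Real.inv_rpow hA.le,
      ← Real.mul_rpow (by positivity) hv.le]
    refine Real.rpow_le_rpow_of_nonpos (by positivity) ?_ hq
    rw [inv_mul_le_iff₀ hA]
    exact h.2

lemma log_two_le {x : ℝ} (hx : 0 ≤ x) : Real.log 2 ≤ Real.log (2 + x) :=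
  Real.log_le_log two_pos (by linarith)

lemma log_two_add_pos {x : ℝ} (hx : 0 ≤ x) : 0 < Real.log (2 + x) :=
  (Real.log_pos one_lt_two).trans_le (log_two_le hx)

lemma one_le_max_div {x y : ℝ} (hx : 0 < x) (hy : 0 < y) : 1 ≤ max (x / y) (y / x) := by
  rcases le_total x y with h | h
  · exact le_max_of_le_right ((one_le_div hx).2 h)
  · exact le_max_of_le_left ((one_le_div hy).2 h)

/-- With M the larger of the two ratios, 2 + x ≤ (2 + y) M, and log M ≤ M^δ/δ. The additive error is
absorbed because log(2+y) ≥ log 2. -/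
lemma exists_log_two_add_le {δ : ℝ} (hδ : 0 < δ) : ∃ C : ℝ, 1 ≤ C ∧ ∀ x y, 0 < x → 0 < y →
    Real.log (2 + x) ≤ C * max (x / y) (y / x) ^ δ * Real.log (2 + y) := by
  have hl2 := Real.log_pos one_lt_two
  have hC : 0 < 1 / (δ * Real.log 2) := by positivity
  refine ⟨1 + 1 / (δ * Real.log 2), by linarith, fun x y hx hy => ?_⟩
  have hL := log_two_add_pos hy.le
  have hM := one_le_max_div hx hy
  set M := max (x / y) (y / x) with hMdef
  have hMδ : 1 ≤ M ^ δ := Real.one_le_rpow hM hδ.le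
  have h1 : 2 + x ≤ (2 + y) * M := by
    have : x / y ≤ M := le_max_left _ _
    rw [div_le_iff₀ hy] at this
    nlinarith
  have h2 : Real.log (2 + x) ≤ Real.log (2 + y) + M ^ δ / δ := by
    refine (Real.log_le_log (by linarith) h1).trans ?_
    rw [Real.log_mul (by linarith) (by linarith)]
    gcongr
    exact Real.log_le_rpow_div (by linarith) hδ
  have h3 : M ^ δ / δ ≤ 1 / (δ * Real.log 2) * M ^ δ * Real.log (2 + y) := by
    have := log_two_le hy.le
    calc M ^ δ / δ = 1 / (δ * Real.log 2) * M ^ δ * Real.log 2 := by field_simp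
      _ ≤ _ := by gcongr
  calc Real.log (2 + x) ≤ Real.log (2 + y) + M ^ δ / δ := h2
    _ ≤ M ^ δ * Real.log (2 + y) + 1 / (δ * Real.log 2) * M ^ δ * Real.log (2 + y) :=
        add_le_add (le_mul_of_one_le_left hL.le hMδ) h3
    _ = _ := by ring

lemma exists_log_two_add_rpow_le (q : ℝ) {ε : ℝ} (hε : 0 < ε) :
    ∃ C : ℝ, 0 < C ∧ ∀ x y, 0 < x → 0 < y →
      Real.log (2 + x) ^ q ≤ C * max (x / y) (y / x) ^ ε * Real.log (2 + y) ^ q := by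
  obtain ⟨C, hC, hle⟩ := exists_log_two_add_le (δ := ε / (|q| + 1)) (by positivity)
  refine ⟨C ^ |q|, by positivity, fun x y hx hy => ?_⟩
  have hM := one_le_max_div hx hy
  have hcomp : Comparable (C * max (x / y) (y / x) ^ (ε / (|q| + 1)))
      (Real.log (2 + x)) (Real.log (2 + y)) :=
    ⟨hle x y hx hy, by rw [max_comm]; exact hle y x hy hx⟩
  have hLy := log_two_add_pos hy.le
  refine (hcomp.rpow_le (by positivity) (log_two_add_pos hx.le) hLy q).trans ?_
  gcongr
  rw [Real.mul_rpow (by positivity) (by positivity), ← Real.rpow_mul (by positivity)]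
  gcongr
  rw [div_mul_eq_mul_div, div_le_iff₀ (by positivity)]
  nlinarith

lemma exists_comparable_log_mul {B : ℝ} (hB : 0 < B) : ∃ A : ℝ, 0 < A ∧ ∀ s, 0 < s →
    Comparable A (Real.log (2 + B * s)) (Real.log (2 + s)) := by
  obtain ⟨C, hC, hle⟩ := exists_log_two_add_le one_pos
  refine ⟨C * max B B⁻¹, mul_pos (by linarith) (lt_max_of_lt_left hB), fun s hs => ?_⟩
  have h1 : B * s / s = B := by field_simp
  have h2 : s / (B * s) = B⁻¹ := by field_simp
  have ha := hle (B * s) s (by positivity) hs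
  have hb := hle s (B * s) hs (by positivity)
  rw [h1, h2, Real.rpow_one] at ha
  rw [h1, h2, Real.rpow_one, max_comm] at hb
  exact ⟨ha, hb⟩

lemma exists_comparable_log_add {lam : ℝ} (hl : 2 ≤ lam) : ∃ A : ℝ, 0 < A ∧ ∀ s, 0 < s →
    Comparable A (Real.log (lam + s)) (Real.log (2 + s)) := by
  have hl2 := Real.log_pos one_lt_two
  have h0 : 0 ≤ Real.log (lam / 2) := Real.log_nonneg (by linarith)
  refine ⟨1 + Real.log (lam / 2) / Real.log 2, by positivity, fun s hs => ⟨?_, ?_⟩⟩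
  · have h1 : Real.log (lam + s) ≤ Real.log (lam / 2) + Real.log (2 + s) := by
      rw [← Real.log_mul (by positivity) (by positivity)]
      exact Real.log_le_log (by positivity) (by nlinarith)
    have h2 : Real.log (lam / 2) ≤ Real.log (lam / 2) / Real.log 2 * Real.log (2 + s) := by
      have := log_two_le hs.le
      calc Real.log (lam / 2) = Real.log (lam / 2) / Real.log 2 * Real.log 2 := by field_simp
        _ ≤ _ := by gcongr
    linarith
  · have h1 : Real.log (2 + s) ≤ Real.log (lam + s) := Real.log_le_log (by linarith) (by linarith)
    have h2 : 0 ≤ Real.log (lam / 2) / Real.log 2 := by positivity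
    have h3 := log_two_add_pos hs.le
    nlinarith

lemma exists_log_rpow_le (q : ℝ) {ε : ℝ} (hε : 0 < ε) : ∃ D : ℝ, 1 ≤ D ∧ ∀ y, 0 < y →
    Real.log (2 + y) ^ q ≤ D * (2 + y) ^ ε := by
  have hl2 := Real.log_pos one_lt_two
  set δ := ε / (|q| + 1) with hδdef
  have hδ : 0 < δ := by positivity
  set C := 1 + 1 / δ + 1 / Real.log 2 with hC
  have hCδ : 1 / δ ≤ C := by
    have : 0 < 1 / Real.log 2 := by positivity
    linarith
  have hC2 : 1 / Real.log 2 ≤ C := by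
    have : 0 < 1 / δ := by positivity
    linarith
  have hC1 : 1 ≤ C := by
    have : 0 < 1 / δ := by positivity
    have : 0 < 1 / Real.log 2 := by positivity
    linarith
  refine ⟨C ^ |q|, Real.one_le_rpow hC1 (abs_nonneg q), fun y hy => ?_⟩
  have hL := log_two_add_pos hy.le
  have hpow : 1 ≤ (2 + y) ^ δ := Real.one_le_rpow (by linarith) hδ.le
  have hcomp : Comparable (C * (2 + y) ^ δ) (Real.log (2 + y)) 1 := by
    constructor
    · calc Real.log (2 + y) ≤ (2 + y) ^ δ / δ := Real.log_le_rpow_div (by linarith) hδ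
        _ = 1 / δ * (2 + y) ^ δ := by ring
        _ ≤ C * (2 + y) ^ δ * 1 := by rw [mul_one]; gcongr
    · calc (1 : ℝ) = 1 / Real.log 2 * 1 * Real.log 2 := by field_simp
        _ ≤ C * (2 + y) ^ δ * Real.log (2 + y) := by
            gcongr
            linarith
  have h := hcomp.rpow_le (by positivity) hL one_pos q
  rw [Real.one_rpow, mul_one, Real.mul_rpow (by positivity) (by positivity),
    ← Real.rpow_mul (by positivity)] at h
  refine h.trans ?_
  gcongr
  · linarith
  · rw [hδdef, div_mul_eq_mul_div, div_le_iff₀ (by positivity)]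
    nlinarith

/-- The logarithmic factor lies between powers (2+y)^{±β/2} up to constants, so for large y the
product lies between powers of 2+y with positive exponents. Logarithms of such powers are
comparable. -/
lemma exists_comparable_log_rpow_mul {β : ℝ} (hβ : 0 < β) (q : ℝ) : ∃ A : ℝ, 0 < A ∧ ∀ y, 0 < y →
    Comparable A (Real.log (2 + y ^ β * Real.log (2 + y) ^ q)) (Real.log (2 + y)) := by
  have hl2 := Real.log_pos one_lt_two
  obtain ⟨D, hD, hup⟩ := exists_log_rpow_le q (half_pos hβ)
  obtain ⟨D', hD', hlow⟩ := exists_log_rpow_le (-q) (half_pos hβ)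
  set A₁ := Real.log (2 + D) / Real.log 2 + (β + β / 2) with hA₁
  have hlD : 0 ≤ Real.log (2 + D) := Real.log_nonneg (by linarith)
  have hA₁0 : 0 < A₁ := by positivity
  set c := Real.log (D' * 2 ^ β) with hc
  have hc0 : 0 ≤ c := Real.log_nonneg (by
    have : (1 : ℝ) ≤ 2 ^ β := Real.one_le_rpow one_le_two hβ.le
    nlinarith)
  set A₂ := 2 / β * (1 + c / Real.log 2) with hA₂
  have hA₂0 : 0 < A₂ := by positivity
  refine ⟨A₁ + A₂ + 2, by positivity, fun y hy => ?_⟩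
  have hL := log_two_add_pos hy.le
  have hLq : 0 < Real.log (2 + y) ^ q := by positivity
  set z := y ^ β * Real.log (2 + y) ^ q with hz
  have hz0 : 0 < z := by positivity
  have hLz := log_two_add_pos hz0.le
  have hLz2 := log_two_le hz0.le
  constructor
  · have h1 : 2 + z ≤ (2 + D) * (2 + y) ^ (β + β / 2) := by
      have hone : 1 ≤ (2 + y) ^ (β + β / 2) := Real.one_le_rpow (by linarith) (by positivity)
      have : z ≤ D * (2 + y) ^ (β + β / 2) := by
        calc z ≤ (2 + y) ^ β * (D * (2 + y) ^ (β / 2)) := by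
              rw [hz]
              gcongr
              · linarith
              · exact hup y hy
          _ = D * (2 + y) ^ (β + β / 2) := by rw [Real.rpow_add (by linarith)]; ring
      linarith
    have h2 : Real.log (2 + z) ≤ Real.log (2 + D) + (β + β / 2) * Real.log (2 + y) := by
      refine (Real.log_le_log (by linarith) h1).trans (le_of_eq ?_)
      rw [Real.log_mul (by linarith) (by positivity), Real.log_rpow (by linarith)]
    have h3 : Real.log (2 + D) ≤ Real.log (2 + D) / Real.log 2 * Real.log (2 + y) := by
      have := log_two_le hy.le
      calc Real.log (2 + D) = Real.log (2 + D) / Real.log 2 * Real.log 2 := by field_simp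
        _ ≤ _ := by gcongr
    calc Real.log (2 + z) ≤ A₁ * Real.log (2 + y) := by rw [hA₁, add_mul]; linarith
      _ ≤ _ := by gcongr; linarith
  -- For y ≤ 2 both logarithms are of order 1. For y ≥ 2, y is at least (2+y)/2, so a positive power
  -- of 2+y survives below z.
  · rcases le_total y 2 with hy2 | hy2
    · have h1 : Real.log (2 + y) ≤ 2 * Real.log 2 := by
        rw [← Real.log_rpow two_pos]
        exact Real.log_le_log (by linarith) (by norm_num; linarith)
      calc Real.log (2 + y) ≤ 2 * Real.log (2 + z) := by linarith
        _ ≤ _ := by gcongr; linarith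
    · have h1 : (2 + y) ^ (β / 2) / (D' * 2 ^ β) ≤ z := by
        have hq := hlow y hy
        rw [Real.rpow_neg hL.le, inv_le_comm₀ hLq (by positivity)] at hq
        have hyβ : ((2 + y) / 2) ^ β ≤ y ^ β :=
          Real.rpow_le_rpow (by linarith) (by linarith) hβ.le
        calc (2 + y) ^ (β / 2) / (D' * 2 ^ β)
            = ((2 + y) / 2) ^ β * (D' * (2 + y) ^ (β / 2))⁻¹ := by
              rw [Real.div_rpow (by linarith) (by norm_num)]
              have : (2 + y) ^ β = (2 + y) ^ (β / 2) * (2 + y) ^ (β / 2) := by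
                rw [← Real.rpow_add (by linarith)]; congr 1; ring
              rw [this]
              field_simp
          _ ≤ z := by rw [hz]; gcongr
      have h2 : β / 2 * Real.log (2 + y) - c ≤ Real.log (2 + z) := by
        rw [hc, ← Real.log_rpow (by linarith), ← Real.log_div (by positivity) (by positivity)]
        exact Real.log_le_log (by positivity) (by linarith)
      have h3 : c ≤ c / Real.log 2 * Real.log (2 + z) := by
        calc c = c / Real.log 2 * Real.log 2 := by field_simp
          _ ≤ _ := by gcongr
      calc Real.log (2 + y) = 2 / β * (β / 2 * Real.log (2 + y)) := by field_simp
        _ ≤ 2 / β * ((1 + c / Real.log 2) * Real.log (2 + z)) :=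
            mul_le_mul_of_nonneg_left (by rw [add_mul]; linarith) (by positivity)
        _ = A₂ * Real.log (2 + z) := by rw [hA₂]; ring
        _ ≤ _ := by gcongr; linarith

end LogComparison

/-! ### Regularity of the logarithmic kernels -/

section LogKernels

variable {n : ℕ} {α : ℝ}

/-- A slowly varying factor costs ε in the exponent: upwards when r ≤ R, downwards when r ≥ R. -/
lemma powerRegular_div_rpow {l : ℝ → ℝ} {ε C : ℝ} (x : ℝ) (hl : ∀ r, 0 < r → 0 < l r)
    (hC : 0 < C) (hle : ∀ r R, 0 < r → 0 < R → l r ≤ C * max (R / r) (r / R) ^ ε * l R) :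
    PowerRegular (fun r => l r / r ^ x) (x + ε) (x - ε) where
  pos r hr := div_pos (hl r hr) (by positivity)
  bound := by
    refine ⟨C, hC, fun r R hr hR => ?_⟩
    have hlR := hl R hR
    have hq : 0 < R / r := by positivity
    have hmax : max (R / r) (r / R) ^ ε * (R / r) ^ x ≤
        max ((R / r) ^ (x + ε)) ((R / r) ^ (x - ε)) := by
      rcases max_choice (R / r) (r / R) with h | h <;> rw [h]
      · refine le_max_of_le_left (le_of_eq ?_)
        rw [Real.rpow_add hq]; ring
      · refine le_max_of_le_right (le_of_eq ?_)
        rw [← inv_div R r, Real.inv_rpow hq.le, Real.rpow_sub hq]; field_simp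
    calc l r / r ^ x ≤ C * max (R / r) (r / R) ^ ε * l R / r ^ x := by gcongr; exact hle r R hr hR
      _ = C * (l R / R ^ x) * (max (R / r) (r / R) ^ ε * (R / r) ^ x) := by
          rw [Real.div_rpow hR.le hr.le]; field_simp
      _ ≤ _ := by gcongr

/-- A margin that keeps `α / 2 ± margin α` inside `(0,1)`. -/
noncomputable def margin (α : ℝ) : ℝ := min (α / 2) (1 - α / 2) / 2

lemma margin_pos (hα : 0 < α) (hα' : α < 2) : 0 < margin α :=
  half_pos (lt_min (by linarith) (by linarith))

lemma margin_lt (hα : 0 < α) (hα' : α < 2) : margin α < α / 2 ∧ margin α < 1 - α / 2 := by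
  have h0 : 0 < min (α / 2) (1 - α / 2) := lt_min (by linarith) (by linarith)
  have h1 := min_le_left (α / 2) (1 - α / 2)
  have h2 := min_le_right (α / 2) (1 - α / 2)
  rw [margin]
  constructor <;> linarith

lemma kerLogPlus_powerRegular (n : ℕ) (hα : 0 < α) (hα' : α < 2) (q : ℝ) :
    PowerRegular (kerLogPlus n α q) (n + (α / 2 + margin α)) (n + (α / 2 - margin α)) := by
  obtain ⟨C, hC, hle⟩ := exists_log_two_add_rpow_le q (margin_pos hα hα')
  have h := powerRegular_div_rpow (l := fun r => Real.log (2 + r⁻¹) ^ q) (ε := margin α)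
    ((n : ℝ) + α / 2) (fun r hr => Real.rpow_pos_of_pos (log_two_add_pos (by positivity)) q) hC
    (fun r R hr hR => by simpa only [inv_div_inv] using hle r⁻¹ R⁻¹ (by positivity) (by positivity))
  rwa [add_assoc, add_sub_assoc] at h

lemma kerLogMinus_powerRegular (n : ℕ) (hα : 0 < α) (hα' : α < 2) (p : ℝ) :
    PowerRegular (kerLogMinus n α p) (n + (α / 2 + margin α)) (n + (α / 2 - margin α)) := by
  obtain ⟨C, hC, hle⟩ := exists_log_two_add_rpow_le p (margin_pos hα hα')
  have h := powerRegular_div_rpow (l := fun r => Real.log (2 + r) ^ p) (ε := margin α)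
    ((n : ℝ) + α / 2) (fun r hr => Real.rpow_pos_of_pos (log_two_add_pos hr.le) p) hC
    (fun r R hr hR => by rw [max_comm]; exact hle r R hr hR)
  rwa [add_assoc, add_sub_assoc] at h

lemma profile_div_rpow (l : ℝ → ℝ) {R : ℝ} (hR : 0 < R) :
    profile n (fun r => l r / r ^ ((n : ℝ) + α / 2)) R = R ^ ((n : ℝ) - α / 2) * l R := by
  have h : R ^ (2 * n) = R ^ ((n : ℝ) - α / 2) * R ^ ((n : ℝ) + α / 2) := by
    rw [← Real.rpow_natCast, ← Real.rpow_add hR]; congr 1; push_cast; ring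
  rw [profile, h]
  field_simp

lemma rpow_rpow_expo (hn : 1 ≤ n) (hα' : α < 2) {x : ℝ} (hx : 0 < x) :
    (x ^ ((n : ℝ) - α / 2)) ^ expo n α = x ^ n := by
  have := sub_half_pos hn hα'
  rw [← Real.rpow_mul hx.le, expo, mul_div_cancel₀ _ this.ne', Real.rpow_natCast]

end LogKernels

/-! ### Logarithmic inequalities and their sharpness -/

section LogInequalities

variable {n : ℕ} {α lam : ℝ}

lemma log_add_pos (hl : 2 ≤ lam) {x : ℝ} (hx : 0 ≤ x) : 0 < Real.log (lam + x) :=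
  Real.log_pos (by linarith)

lemma profile_kerLogPlus (q : ℝ) {R : ℝ} (hR : 0 < R) :
    profile n (kerLogPlus n α q) R = R ^ ((n : ℝ) - α / 2) * Real.log (2 + R⁻¹) ^ q :=
  profile_div_rpow (fun r => Real.log (2 + r⁻¹) ^ q) hR

lemma profile_kerLogMinus (p : ℝ) {R : ℝ} (hR : 0 < R) :
    profile n (kerLogMinus n α p) R = R ^ ((n : ℝ) - α / 2) * Real.log (2 + R) ^ p :=
  profile_div_rpow (fun r => Real.log (2 + r) ^ p) hR

lemma NlogPlus_pos (hl : 2 ≤ lam) (q : ℝ) {s : ℝ≥0} (hs : 0 < s) : 0 < NlogPlus n α q lam s := by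
  have hs' : (0 : ℝ) < s := by exact_mod_cast hs
  have := log_add_pos hl hs'.le
  rw [NlogPlus, ENNReal.ofReal_pos]
  positivity

lemma NlogMinus_pos (hl : 2 ≤ lam) (p : ℝ) {s : ℝ≥0} (hs : 0 < s) :
    0 < NlogMinus n α p lam s := by
  have hs' : (0 : ℝ) < s := by exact_mod_cast hs
  have := log_add_pos hl (inv_pos.2 hs').le
  rw [NlogMinus, ENNReal.ofReal_pos]
  positivity

lemma exists_comparable_log_add_rpow_mul (hl : 2 ≤ lam) {β : ℝ} (hβ : 0 < β) (q : ℝ) :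
    ∃ A : ℝ, 0 < A ∧ ∀ y, 0 < y →
      Comparable A (Real.log (lam + y ^ β * Real.log (2 + y) ^ q)) (Real.log (2 + y)) := by
  obtain ⟨A, hA, h⟩ := exists_comparable_log_add hl
  obtain ⟨A', hA', h'⟩ := exists_comparable_log_rpow_mul hβ q
  refine ⟨A * A', by positivity, fun y hy => ?_⟩
  have := log_two_add_pos hy.le
  exact (h _ (by positivity)).trans hA.le hA'.le (h' y hy)

theorem exists_orliczSobolev_NlogPlus (hn : 1 ≤ n) (hα : 0 < α) (hα' : α < 2) (q : ℝ)
    (hl : 2 ≤ lam) (hY : IsYoung (NlogPlus n α q lam)) :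
    ∃ C : ℝ, 0 < C ∧ OrliczSobolev n (NlogPlus n α q lam) (kerLogPlus n α q) C := by
  have hm := margin_lt hα hα'
  have hm0 := margin_pos hα hα'
  have hβ := sub_half_pos hn hα'
  have he := one_lt_expo hn hα hα'
  obtain ⟨A, hA, hcomp⟩ := exists_comparable_log_add_rpow_mul hl hβ (-q)
  have hreg := kerLogPlus_powerRegular n hα hα' q
  have hn0 : (0 : ℝ) ≤ n := by positivity
  refine hreg.exists_orliczSobolev hn (by linarith) (by linarith)
    (Measurable.indicator (by unfold kerLogPlus; fun_prop) measurableSet_Ioi) hY.starShaped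
    (fun s hs => NlogPlus_pos hl q hs) (C₁ := 1) (C₂ := (A ^ |q|) ^ expo n α) one_pos
    fun R hR => ?_
  have hp := hreg.profile_pos n hR
  have hx : 0 < R⁻¹ := by positivity
  have hL := log_two_add_pos hx.le
  -- At s = 1/profile(R), log(λ+s) is comparable with log(2+1/R), so its q-th power cancels the
  -- logarithm in s up to a constant and leaves R^{-(n-α/2)}.
  have hz : 1 / profile n (kerLogPlus n α q) R =
      R⁻¹ ^ ((n : ℝ) - α / 2) * Real.log (2 + R⁻¹) ^ (-q) := by
    rw [profile_kerLogPlus q hR, Real.inv_rpow hR.le, Real.rpow_neg hL.le]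
    field_simp
  rw [NlogPlus, Real.coe_toNNReal _ (by positivity), hz]
  refine ENNReal.ofReal_le_ofReal ?_
  have hz0 : 0 < R⁻¹ ^ ((n : ℝ) - α / 2) * Real.log (2 + R⁻¹) ^ (-q) := by positivity
  have hLz := log_add_pos hl hz0.le
  have h1 := (hcomp _ hx).rpow_le hA hLz hL q
  have hrn : 1 / R ^ n = (R⁻¹ ^ ((n : ℝ) - α / 2)) ^ expo n α := by
    rw [rpow_rpow_expo hn hα' hx, inv_pow, one_div]
  rw [div_eq_mul_one_div _ (R ^ n), hrn, ← Real.mul_rpow (by positivity) (by positivity)]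
  refine Real.rpow_le_rpow (by positivity) ?_ (by linarith)
  refine (mul_le_mul_of_nonneg_left h1 hz0.le).trans (le_of_eq ?_)
  have hLq : 0 < Real.log (2 + R⁻¹) ^ q := by positivity
  rw [Real.rpow_neg hL.le]
  generalize Real.log (2 + R⁻¹) ^ q = t at hLq ⊢
  field_simp

theorem exists_orliczSobolev_NlogMinus (hn : 1 ≤ n) (hα : 0 < α) (hα' : α < 2) (p : ℝ)
    (hl : 2 ≤ lam) (hY : IsYoung (NlogMinus n α p lam)) :
    ∃ C : ℝ, 0 < C ∧ OrliczSobolev n (NlogMinus n α p lam) (kerLogMinus n α p) C := by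
  have hm := margin_lt hα hα'
  have hm0 := margin_pos hα hα'
  have hβ := sub_half_pos hn hα'
  have he := one_lt_expo hn hα hα'
  obtain ⟨A, hA, hcomp⟩ := exists_comparable_log_add_rpow_mul hl hβ p
  have hreg := kerLogMinus_powerRegular n hα hα' p
  have hn0 : (0 : ℝ) ≤ n := by positivity
  refine hreg.exists_orliczSobolev hn (by linarith) (by linarith)
    (Measurable.indicator (by unfold kerLogMinus; fun_prop) measurableSet_Ioi) hY.starShaped
    (fun s hs => NlogMinus_pos hl p hs) (C₁ := 1) (C₂ := (A ^ |p|) ^ expo n α) one_pos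
    fun R hR => ?_
  have hp := hreg.profile_pos n hR
  have hL := log_two_add_pos hR.le
  rw [NlogMinus, Real.coe_toNNReal _ (by positivity), one_div, inv_inv]
  refine ENNReal.ofReal_le_ofReal ?_
  rw [profile_kerLogMinus p hR]
  have hz0 : 0 < R ^ ((n : ℝ) - α / 2) * Real.log (2 + R) ^ p := by positivity
  have hLz := log_add_pos hl hz0.le
  have h1 := (hcomp _ hR).rpow_le hA hLz hL p
  have hrn : 1 / R ^ n = (R⁻¹ ^ ((n : ℝ) - α / 2)) ^ expo n α := by
    rw [rpow_rpow_expo hn hα' (by positivity), inv_pow, one_div]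
  rw [div_eq_mul_one_div _ (R ^ n), hrn, ← Real.mul_rpow (by positivity) (by positivity)]
  refine Real.rpow_le_rpow (by positivity) ?_ (by linarith)
  refine (mul_le_mul_of_nonneg_left h1 (by positivity)).trans (le_of_eq ?_)
  rw [Real.inv_rpow hR.le]
  field_simp

lemma exists_log_mul_rpow_le (hl : 2 ≤ lam) {B : ℝ} (hB : 0 < B) (q : ℝ) :
    ∃ D : ℝ, 0 < D ∧ ∀ s, 0 < s → Real.log (2 + B * s) ^ q ≤ D * Real.log (lam + s) ^ q := by
  obtain ⟨A, hA, h⟩ := exists_comparable_log_mul hB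
  obtain ⟨A', hA', h'⟩ := exists_comparable_log_add hl
  refine ⟨(A * A') ^ |q|, by positivity, fun s hs => ?_⟩
  exact ((h s hs).trans hA.le hA'.le (h' s hs).symm).rpow_le (by positivity)
    (log_two_add_pos (by positivity)) (log_add_pos hl hs.le) q

/-- Approximate inversion of `x ↦ x ^ β * log (2 + x) ^ (-q)`. -/
lemma exists_approx_inverse {β : ℝ} (hβ : 0 < β) (q : ℝ) : ∃ A : ℝ, 0 < A ∧ ∀ y, 0 < y →
    ∃ x, 0 < x ∧ x ^ β = y * Real.log (2 + y) ^ q ∧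
      Real.log (2 + x) ^ q ≤ A * Real.log (2 + y) ^ q ∧
      Real.log (2 + y) ^ q ≤ A * Real.log (2 + x) ^ q := by
  obtain ⟨A, hA, h⟩ := exists_comparable_log_rpow_mul (inv_pos.2 hβ) (q * β⁻¹)
  refine ⟨A ^ |q|, by positivity, fun y hy => ?_⟩
  have hL := log_two_add_pos hy.le
  have hx : 0 < y ^ β⁻¹ * Real.log (2 + y) ^ (q * β⁻¹) := by positivity
  have hLx := log_two_add_pos hx.le
  refine ⟨_, hx, ?_, (h y hy).rpow_le hA hLx hL q, (h y hy).symm.rpow_le hA hL hLx q⟩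
  rw [Real.rpow_mul hL.le, ← Real.mul_rpow hy.le (by positivity),
    Real.rpow_inv_rpow (by positivity) hβ.ne']

theorem sharp_NlogPlus (hn : 1 ≤ n) (hα : 0 < α) (hα' : α < 2) (q : ℝ) (hl : 2 ≤ lam) :
    Sharp n (NlogPlus n α q lam) (kerLogPlus n α q) := by
  have hm := margin_lt hα hα'
  have hm0 := margin_pos hα hα'
  have hβ := sub_half_pos hn hα'
  have he := one_lt_expo hn hα hα'
  obtain ⟨A, hA, hinv⟩ := exists_approx_inverse hβ q
  refine (kerLogPlus_powerRegular n hα hα' q).sharp hn (by linarith) (by linarith) (by linarith)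
    (by linarith) (fun s hs => ⟨(NlogPlus_pos hl q hs).ne', ENNReal.ofReal_ne_top⟩) fun B hB => ?_
  obtain ⟨D, hD, hlog⟩ := exists_log_mul_rpow_le hl (show 0 < A * B by positivity) q
  refine ⟨(A * B * D) ^ expo n α, fun s hs => ?_⟩
  have hs' : (0 : ℝ) < s := by exact_mod_cast hs
  -- The radius is 1/x. The factor A in the argument compensates for the loss in replacing log(2+x)
  -- by log(2+ABs).
  obtain ⟨x, hx, hxβ, hx1, -⟩ := hinv (A * B * s) (by positivity)
  have hL := log_two_add_pos hx.le
  have hLs := log_add_pos hl hs'.le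
  have hLy := log_two_add_pos (show 0 ≤ A * B * s by positivity)
  refine ⟨x⁻¹, by positivity, ?_, ?_⟩
  · rw [profile_kerLogPlus q (by positivity), inv_inv, Real.inv_rpow hx.le, hxβ, ← mul_assoc,
      mul_right_comm, mul_inv_le_iff₀ (by positivity), one_mul]
    calc B * s * Real.log (2 + x) ^ q ≤ B * s * (A * Real.log (2 + A * B * s) ^ q) := by gcongr
      _ = _ := by ring
  · rw [NlogPlus, ← ENNReal.ofReal_mul (by positivity), one_div, inv_pow, inv_inv,
      ← rpow_rpow_expo hn hα' hx, hxβ, ← Real.mul_rpow (by positivity) (by positivity)]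
    refine ENNReal.ofReal_le_ofReal (Real.rpow_le_rpow (by positivity) ?_ (by linarith))
    calc A * B * s * Real.log (2 + A * B * s) ^ q
        ≤ A * B * s * (D * Real.log (lam + s) ^ q) := by gcongr; exact hlog s hs'
      _ = _ := by ring

theorem sharp_NlogMinus (hn : 1 ≤ n) (hα : 0 < α) (hα' : α < 2) (p : ℝ) (hl : 2 ≤ lam) :
    Sharp n (NlogMinus n α p lam) (kerLogMinus n α p) := by
  have hm := margin_lt hα hα'
  have hm0 := margin_pos hα hα'
  have hβ := sub_half_pos hn hα'
  have he := one_lt_expo hn hα hα'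
  obtain ⟨A, hA, hinv⟩ := exists_approx_inverse hβ (-p)
  refine (kerLogMinus_powerRegular n hα hα' p).sharp hn (by linarith) (by linarith) (by linarith)
    (by linarith) (fun s hs => ⟨(NlogMinus_pos hl p hs).ne', ENNReal.ofReal_ne_top⟩) fun B hB => ?_
  obtain ⟨D, hD, hlog⟩ := exists_log_mul_rpow_le hl (show 0 < (A * B)⁻¹ by positivity) p
  refine ⟨(A * B * D) ^ expo n α, fun s hs => ?_⟩
  have hs' : (0 : ℝ) < s := by exact_mod_cast hs
  have hy : 0 < (A * B)⁻¹ * (s : ℝ)⁻¹ := by positivity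
  -- Here the profile itself is inverted at 1/(ABs), whence the exponent -p; A again pays for
  -- changing the argument of the logarithm.
  obtain ⟨R, hR, hRβ, -, hR2⟩ := hinv ((A * B)⁻¹ * (s : ℝ)⁻¹) hy
  have hL := log_two_add_pos hR.le
  have hLs := log_add_pos hl (inv_pos.2 hs').le
  have hLy := log_two_add_pos hy.le
  refine ⟨R, hR, ?_, ?_⟩
  · rw [profile_kerLogMinus p hR, hRβ]
    calc B * s * ((A * B)⁻¹ * (s : ℝ)⁻¹ * Real.log (2 + (A * B)⁻¹ * (s : ℝ)⁻¹) ^ (-p) *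
          Real.log (2 + R) ^ p)
        ≤ B * s * ((A * B)⁻¹ * (s : ℝ)⁻¹ * (A * Real.log (2 + R) ^ (-p)) *
          Real.log (2 + R) ^ p) := by gcongr
      _ = 1 := by rw [Real.rpow_neg hL.le]; field_simp
  · have hRn : 1 / R ^ n = (A * B * s * Real.log (2 + (A * B)⁻¹ * (s : ℝ)⁻¹) ^ p) ^ expo n α := by
      rw [← rpow_rpow_expo hn hα' hR, hRβ, one_div, ← Real.inv_rpow (by positivity),
        Real.rpow_neg hLy.le]
      congr 1
      field_simp
    rw [hRn, NlogMinus, ← ENNReal.ofReal_mul (by positivity),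
      ← Real.mul_rpow (by positivity) (by positivity)]
    refine ENNReal.ofReal_le_ofReal (Real.rpow_le_rpow (by positivity) ?_ (by linarith))
    calc A * B * s * Real.log (2 + (A * B)⁻¹ * (s : ℝ)⁻¹) ^ p
        ≤ A * B * s * (D * Real.log (lam + (s : ℝ)⁻¹) ^ p) := by
          gcongr; exact hlog _ (by positivity)
      _ = _ := by ring

end LogInequalities

/-! ### The logarithmic functions are Young for large λ -/

section YoungFunctions

/-- The second derivative of exp(ψ(log s)) is exp(ψ) s^{-2} (ψ'(ψ' - 1) + ψ'') with everything taken
at log s. -/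
lemma convexOn_exp_comp_log {ψ ψ₁ ψ₂ : ℝ → ℝ} (h₁ : ∀ v, HasDerivAt ψ (ψ₁ v) v)
    (h₂ : ∀ v, HasDerivAt ψ₁ (ψ₂ v) v) (hnn : ∀ v, 0 ≤ ψ₁ v * (ψ₁ v - 1) + ψ₂ v) :
    ConvexOn ℝ (Set.Ioi 0) fun s => Real.exp (ψ (Real.log s)) := by
  have hlog : ∀ s : ℝ, 0 < s → HasDerivAt Real.log s⁻¹ s := fun s hs => Real.hasDerivAt_log hs.ne'
  have hd : ∀ s : ℝ, 0 < s → HasDerivAt (fun s => Real.exp (ψ (Real.log s)))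
      (Real.exp (ψ (Real.log s)) * (ψ₁ (Real.log s) * s⁻¹)) s := fun s hs =>
    ((h₁ (Real.log s)).comp s (hlog s hs)).exp
  have hd2 : ∀ s : ℝ, 0 < s → HasDerivAt
      (fun s => Real.exp (ψ (Real.log s)) * (ψ₁ (Real.log s) * s⁻¹))
      (Real.exp (ψ (Real.log s)) * (ψ₁ (Real.log s) * s⁻¹) * (ψ₁ (Real.log s) * s⁻¹) +
        Real.exp (ψ (Real.log s)) *
          (ψ₂ (Real.log s) * s⁻¹ * s⁻¹ + ψ₁ (Real.log s) * (-(s ^ 2)⁻¹))) s := fun s hs =>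
    (hd s hs).mul (((h₂ (Real.log s)).comp s (hlog s hs)).mul (hasDerivAt_inv hs.ne'))
  refine convexOn_of_hasDerivWithinAt2_nonneg (convex_Ioi 0)
    (fun s hs => (hd s hs).continuousAt.continuousWithinAt)
    (fun s hs => (hd s (by simpa using hs)).hasDerivWithinAt)
    (fun s hs => (hd2 s (by simpa using hs)).hasDerivWithinAt) fun s hs => ?_
  have hs0 : 0 < s := by simpa using hs
  have heq : Real.exp (ψ (Real.log s)) * (ψ₁ (Real.log s) * s⁻¹) * (ψ₁ (Real.log s) * s⁻¹) +
        Real.exp (ψ (Real.log s)) *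
          (ψ₂ (Real.log s) * s⁻¹ * s⁻¹ + ψ₁ (Real.log s) * (-(s ^ 2)⁻¹)) =
      Real.exp (ψ (Real.log s)) * (s ^ 2)⁻¹ *
        (ψ₁ (Real.log s) * (ψ₁ (Real.log s) - 1) + ψ₂ (Real.log s)) := by
    field_simp
    ring
  rw [heq]
  exact mul_nonneg (by positivity) (hnn _)

/-- The condition ψ' ≥ 1 says that N(s)/s increases. That gives monotonicity, growth at infinity and
convexity for chords ending at 0; the second-order condition handles the remaining chords. -/
lemma isYoung_of_exp_comp_log {N : ℝ≥0 → ℝ≥0∞} {ψ ψ₁ ψ₂ : ℝ → ℝ}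
    (h₁ : ∀ v, HasDerivAt ψ (ψ₁ v) v) (h₂ : ∀ v, HasDerivAt ψ₁ (ψ₂ v) v)
    (hone : ∀ v, 1 ≤ ψ₁ v) (hnn : ∀ v, 0 ≤ ψ₁ v * (ψ₁ v - 1) + ψ₂ v) (h0 : N 0 = 0)
    (hN : ∀ s : ℝ≥0, 0 < s → N s = ENNReal.ofReal (Real.exp (ψ (Real.log s)))) : IsYoung N := by
  have hmono : Monotone fun v => ψ v - v :=
    monotone_of_hasDerivAt_nonneg (fun v => (h₁ v).sub (hasDerivAt_id v))
      fun v => by simpa using hone v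
  have hstar : StarShaped N := by
    intro a u ha
    rcases eq_or_ne a 0 with rfl | ha0
    · simp [h0]
    rcases eq_or_ne u 0 with rfl | hu0
    · simp [h0]
    have ha' : 0 < a := pos_iff_ne_zero.2 ha0
    have hu' : 0 < u := pos_iff_ne_zero.2 hu0
    have haR : (0 : ℝ) < a := by exact_mod_cast ha'
    have huR : (0 : ℝ) < u := by exact_mod_cast hu'
    rw [hN _ (mul_pos ha' hu'), hN _ hu', ← ENNReal.ofReal_coe_nnreal,
      ← ENNReal.ofReal_mul haR.le]
    refine ENNReal.ofReal_le_ofReal ?_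
    rw [NNReal.coe_mul, Real.log_mul haR.ne' huR.ne']
    nth_rewrite 2 [← Real.exp_log haR]
    rw [← Real.exp_add, Real.exp_le_exp]
    have hla : Real.log a ≤ 0 := Real.log_nonpos haR.le (by exact_mod_cast ha)
    have := hmono (show Real.log a + Real.log u ≤ Real.log u by linarith)
    simp only at this
    linarith
  refine ⟨⟨convex_univ, fun x _ y _ a b _ _ hab => ?_⟩, hstar.mono, h0, ?_,
    ⟨1, one_pos, by rw [hN 1 one_pos]; exact ENNReal.ofReal_ne_top⟩⟩
  · have ha1 : a ≤ 1 := hab ▸ le_self_add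
    have hb1 : b ≤ 1 := hab ▸ le_add_self
    rcases eq_or_ne x 0 with rfl | hx0
    · simpa [h0, ENNReal.smul_def] using hstar b y hb1
    rcases eq_or_ne y 0 with rfl | hy0
    · simpa [h0, ENNReal.smul_def] using hstar a x ha1
    have hx : 0 < x := pos_iff_ne_zero.2 hx0
    have hy : 0 < y := pos_iff_ne_zero.2 hy0
    have hpos : 0 < a * x + b * y := by
      rcases eq_or_ne a 0 with rfl | ha0
      · rw [zero_add] at hab; simpa [hab] using hy
      · exact add_pos_of_pos_of_nonneg (mul_pos (pos_iff_ne_zero.2 ha0) hx) (zero_le)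
    have hc := (convexOn_exp_comp_log h₁ h₂ hnn).2 (x := (x : ℝ)) (by simpa using hx)
      (y := (y : ℝ)) (by simpa using hy) (NNReal.coe_nonneg a) (NNReal.coe_nonneg b)
      (by exact_mod_cast hab)
    simp only [smul_eq_mul, ENNReal.smul_def] at hc ⊢
    rw [hN _ hpos, hN x hx, hN y hy, ← ENNReal.ofReal_coe_nnreal (p := a),
      ← ENNReal.ofReal_coe_nnreal (p := b), ← ENNReal.ofReal_mul (NNReal.coe_nonneg a),
      ← ENNReal.ofReal_mul (NNReal.coe_nonneg b),
      ← ENNReal.ofReal_add (by positivity) (by positivity)]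
    refine ENNReal.ofReal_le_ofReal ?_
    push_cast
    exact hc
  · rw [ENNReal.tendsto_nhds_top_iff_nnreal]
    intro M
    set c : ℝ≥0 := (Real.exp (ψ (Real.log ((1 : ℝ≥0) : ℝ)))).toNNReal with hc
    have hc0 : 0 < c := Real.toNNReal_pos.2 (Real.exp_pos _)
    have hN1 : N 1 = c := hN 1 one_pos
    filter_upwards [Filter.eventually_ge_atTop (max 1 ((M + 1) / c))] with s hs
    have hs1 : 1 ≤ s := (le_max_left _ _).trans hs
    have hs0 : 0 < s := one_pos.trans_le hs1
    have hsM : M + 1 ≤ s * c := (div_le_iff₀ hc0).1 ((le_max_right _ _).trans hs)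
    have h := hstar s⁻¹ s (inv_le_one_of_one_le₀ hs1)
    rw [inv_mul_cancel₀ hs0.ne', hN1, ENNReal.coe_inv hs0.ne', mul_comm, ← div_eq_mul_inv,
      ENNReal.le_div_iff_mul_le (by simp [hs0.ne']) (by simp)] at h
    refine lt_of_lt_of_le ?_ h
    rw [← ENNReal.coe_mul, ENNReal.coe_lt_coe, mul_comm]
    exact (lt_add_one M).trans_le hsM

/-- The bound on η keeps both perturbations below (e-1)/2. Hence ψ' ≥ 1 + (e-1)/2, so ψ'(ψ' - 1) ≥
(e-1)/2, which outweighs ψ''. -/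
lemma isYoung_of_perturbed_power {N : ℝ≥0 → ℝ≥0∞} {G g₁ g₂ : ℝ → ℝ} {e q η : ℝ}
    (hG : ∀ v, HasDerivAt G (g₁ v) v) (hg : ∀ v, HasDerivAt g₁ (g₂ v) v)
    (hb₁ : ∀ v, |g₁ v| ≤ η) (hb₂ : ∀ v, |g₂ v| ≤ η) (he : 1 < e)
    (hη : 2 * e * (|q| * η) ≤ e - 1) (h0 : N 0 = 0)
    (hN : ∀ s : ℝ≥0, 0 < s →
      N s = ENNReal.ofReal (Real.exp (e * (Real.log s + q * G (Real.log s))))) : IsYoung N := by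
  have hq : ∀ x : ℝ, |x| ≤ η → |e * (q * x)| ≤ (e - 1) / 2 := by
    intro x hx
    rw [abs_mul, abs_mul, abs_of_pos (by linarith)]
    have : e * (|q| * |x|) ≤ e * (|q| * η) := by gcongr
    linarith
  have h1 : ∀ v, 1 ≤ e * (1 + q * g₁ v) ∧ (e - 1) / 2 ≤ e * (1 + q * g₁ v) - 1 := by
    intro v
    have := (abs_le.1 (hq _ (hb₁ v))).1
    rw [mul_add, mul_one]
    constructor <;> linarith
  refine isYoung_of_exp_comp_log (ψ := fun v => e * (v + q * G v))
    (ψ₁ := fun v => e * (1 + q * g₁ v)) (ψ₂ := fun v => e * (q * g₂ v))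
    (fun v => ((hasDerivAt_id v).add ((hG v).const_mul q)).const_mul e)
    (fun v => (((hg v).const_mul q).const_add 1).const_mul e) (fun v => (h1 v).1) (fun v => ?_)
    h0 hN
  have h2 := (abs_le.1 (hq _ (hb₂ v))).1
  obtain ⟨h3, h4⟩ := h1 v
  nlinarith

/-- First derivative of `v ↦ log (log (lam + exp v))`. -/
noncomputable def logLogDeriv (lam v : ℝ) : ℝ :=
  Real.exp v / ((lam + Real.exp v) * Real.log (lam + Real.exp v))

/-- Second derivative of `v ↦ log (log (lam + exp v))`. -/
noncomputable def logLogDeriv₂ (lam v : ℝ) : ℝ :=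
  Real.exp v * (lam * Real.log (lam + Real.exp v) - Real.exp v) /
    ((lam + Real.exp v) * Real.log (lam + Real.exp v)) ^ 2

variable {lam : ℝ}

lemma log_le_log_add_exp (hl : 2 ≤ lam) (v : ℝ) :
    Real.log lam ≤ Real.log (lam + Real.exp v) :=
  Real.log_le_log (by linarith) (by linarith [Real.exp_pos v])

lemma hasDerivAt_log_log (hl : 2 ≤ lam) (v : ℝ) :
    HasDerivAt (fun v => Real.log (Real.log (lam + Real.exp v))) (logLogDeriv lam v) v := by
  have hE := Real.exp_pos v
  have hL := log_add_pos hl hE.le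
  have h := ((((Real.hasDerivAt_exp v).const_add lam).log (by positivity)).log hL.ne')
  refine h.congr_deriv ?_
  rw [logLogDeriv]
  field_simp

lemma hasDerivAt_logLogDeriv (hl : 2 ≤ lam) (v : ℝ) :
    HasDerivAt (logLogDeriv lam) (logLogDeriv₂ lam v) v := by
  have hE := Real.exp_pos v
  have hL := log_add_pos hl hE.le
  have hS := (Real.hasDerivAt_exp v).const_add lam
  have h := (Real.hasDerivAt_exp v).div (hS.mul (hS.log (by positivity)))
    (mul_pos (show 0 < lam + Real.exp v by positivity) hL).ne'
  refine h.congr_deriv ?_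
  rw [logLogDeriv₂]
  simp only [Pi.mul_apply]
  field_simp
  ring

lemma abs_logLogDeriv_le (hl : 2 ≤ lam) (hl1 : 1 ≤ Real.log lam) (v : ℝ) :
    |logLogDeriv lam v| ≤ 1 / Real.log lam := by
  have hE := Real.exp_pos v
  have hle := log_le_log_add_exp hl v
  have hL := log_add_pos hl hE.le
  rw [logLogDeriv, abs_of_pos (by positivity), div_le_div_iff₀ (by positivity) (by linarith)]
  have : Real.exp v ≤ lam + Real.exp v := by linarith
  rw [one_mul]
  exact mul_le_mul this hle (by linarith) (by linarith)

lemma abs_logLogDeriv₂_le (hl : 2 ≤ lam) (hl1 : 1 ≤ Real.log lam) (v : ℝ) :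
    |logLogDeriv₂ lam v| ≤ 1 / Real.log lam := by
  have hE := Real.exp_pos v
  have hle := log_le_log_add_exp hl v
  have hL := log_add_pos hl hE.le
  refine le_trans ?_ (one_div_le_one_div_of_le (by linarith) hle)
  rw [logLogDeriv₂, abs_div, abs_of_pos (a := (_ : ℝ) ^ 2) (by positivity),
    div_le_div_iff₀ (by positivity) hL, one_mul]
  set E := Real.exp v
  set L := Real.log (lam + E)
  have hL1 : 1 ≤ L := hl1.trans hle
  -- L ≥ 1 is what lets E² be absorbed into E² L.
  have habs : |E * (lam * L - E)| ≤ (lam + E) ^ 2 * L := by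
    have hlE : 0 < lam * E := by positivity
    rw [abs_le]
    constructor
    · nlinarith [mul_pos hlE (show 0 < L by linarith), sq_nonneg lam, sq_nonneg E,
        mul_nonneg (sq_nonneg E) (show 0 ≤ L - 1 by linarith),
        mul_nonneg (sq_nonneg lam) (show 0 ≤ L by linarith)]
    · nlinarith [mul_pos hlE (show 0 < L by linarith), sq_nonneg E,
        mul_nonneg (sq_nonneg E) (show 0 ≤ L by linarith),
        mul_nonneg (sq_nonneg lam) (show 0 ≤ L by linarith)]
  calc |E * (lam * L - E)| * L ≤ (lam + E) ^ 2 * L * L := by gcongr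
    _ = ((lam + E) * L) ^ 2 := by ring

variable {n : ℕ} {α : ℝ}

lemma mul_rpow_rpow_eq_exp {s l q e : ℝ} (hs : 0 < s) (hl : 0 < l) :
    (s * l ^ q) ^ e = Real.exp (e * (Real.log s + q * Real.log l)) := by
  rw [Real.rpow_def_of_pos (by positivity), Real.log_mul hs.ne' (by positivity), Real.log_rpow hl,
    mul_comm]

lemma isYoung_NlogPlus (hn : 1 ≤ n) (hα : 0 < α) (hα' : α < 2) {q : ℝ} (hl : 2 ≤ lam)
    (hl1 : 1 ≤ Real.log lam)
    (hq : 2 * expo n α * (|q| * (1 / Real.log lam)) ≤ expo n α - 1) :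
    IsYoung (NlogPlus n α q lam) := by
  have he := one_lt_expo hn hα hα'
  refine isYoung_of_perturbed_power (hasDerivAt_log_log hl) (hasDerivAt_logLogDeriv hl)
    (abs_logLogDeriv_le hl hl1) (abs_logLogDeriv₂_le hl hl1) he hq ?_ fun s hs => ?_
  · simp [NlogPlus, Real.zero_rpow (show expo n α ≠ 0 by linarith)]
  · have hs' : (0 : ℝ) < s := by exact_mod_cast hs
    rw [NlogPlus, mul_rpow_rpow_eq_exp hs' (log_add_pos hl hs'.le), Real.exp_log hs']

lemma isYoung_NlogMinus (hn : 1 ≤ n) (hα : 0 < α) (hα' : α < 2) {p : ℝ} (hl : 2 ≤ lam)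
    (hl1 : 1 ≤ Real.log lam)
    (hp : 2 * expo n α * (|p| * (1 / Real.log lam)) ≤ expo n α - 1) :
    IsYoung (NlogMinus n α p lam) := by
  have he := one_lt_expo hn hα hα'
  have hneg : ∀ v : ℝ, HasDerivAt (fun v : ℝ => -v) (-1) v := fun v => hasDerivAt_neg v
  refine isYoung_of_perturbed_power
    (G := fun v => Real.log (Real.log (lam + Real.exp (-v))))
    (g₁ := fun v => -logLogDeriv lam (-v)) (g₂ := fun v => logLogDeriv₂ lam (-v))
    (fun v => ((hasDerivAt_log_log hl (-v)).comp v (hneg v)).congr_deriv (by ring))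
    (fun v => ((hasDerivAt_logLogDeriv hl (-v)).comp v (hneg v)).neg.congr_deriv (by ring))
    (fun v => by rw [abs_neg]; exact abs_logLogDeriv_le hl hl1 (-v))
    (fun v => abs_logLogDeriv₂_le hl hl1 (-v)) he hp ?_ fun s hs => ?_
  · simp [NlogMinus, Real.zero_rpow (show expo n α ≠ 0 by linarith)]
  · have hs' : (0 : ℝ) < s := by exact_mod_cast hs
    rw [NlogMinus, mul_rpow_rpow_eq_exp hs' (log_add_pos hl (inv_pos.2 hs').le), Real.exp_neg,
      Real.exp_log hs']

theorem exists_isYoung_log (hn : 1 ≤ n) (hα : 0 < α) (hα' : α < 2) (q p : ℝ) :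
    ∃ lam₀ : ℝ, 2 ≤ lam₀ ∧ ∀ lam : ℝ, lam₀ ≤ lam →
      IsYoung (NlogPlus n α q lam) ∧ IsYoung (NlogMinus n α p lam) := by
  have he := one_lt_expo hn hα hα'
  have he' : 0 < expo n α - 1 := by linarith
  -- Once log λ ≥ m, the smallness condition with η = 1/log λ holds for q and for p at once.
  set m : ℝ := 2 * expo n α * (|q| + |p|) / (expo n α - 1) with hm
  refine ⟨max 2 (Real.exp (max 1 m)), le_max_left _ _, fun lam hlam => ?_⟩
  have hl : 2 ≤ lam := (le_max_left _ _).trans hlam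
  have hlog : max 1 m ≤ Real.log lam := by
    rw [Real.le_log_iff_exp_le (by linarith)]
    exact (le_max_right _ _).trans hlam
  have hl1 : 1 ≤ Real.log lam := (le_max_left _ _).trans hlog
  have hmlog : m ≤ Real.log lam := (le_max_right _ _).trans hlog
  rw [hm, div_le_iff₀ he'] at hmlog
  have hbound : ∀ x : ℝ, |x| ≤ |q| + |p| →
      2 * expo n α * (|x| * (1 / Real.log lam)) ≤ expo n α - 1 := by
    intro x hx
    rw [← mul_assoc, mul_one_div, div_le_iff₀ (by linarith), mul_comm (expo n α - 1)]
    refine le_trans ?_ hmlog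
    gcongr
  exact ⟨isYoung_NlogPlus hn hα hα' hl hl1 (hbound q (by linarith [abs_nonneg p])),
    isYoung_NlogMinus hn hα hα' hl hl1 (hbound p (by linarith [abs_nonneg q]))⟩

end YoungFunctions

end OrliczIso

theorem theorem1p1 (n : ℕ) (hn : 1 ≤ n) :
    (∀ (α : ℝ) (h : ℝ → ℝ), 0 < α → α < 2 → OrliczIso.MemH n α h →
      (∃ C : ℝ, 0 < C ∧
        OrliczIso.OrliczSobolev n (OrliczIso.Nh n α h) (OrliczIso.kerH n α h) C) ∧
      0 < ⨅ (A : Set (OrliczIso.Rn n))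
            (_ : MeasurableSet A ∧ 0 < volume A ∧ volume A < ⊤),
          OrliczIso.genInv (OrliczIso.Nh n α h) (volume A)⁻¹ *
            OrliczIso.perimeter (OrliczIso.kerH n α h) A) ∧
    (∀ α₁ α₂ : ℝ, 0 < α₁ → α₁ < 2 → 0 < α₂ → α₂ < 2 →
      (∃ C : ℝ, 0 < C ∧
        OrliczIso.OrliczSobolev n (OrliczIso.Nmin n α₁ α₂) (OrliczIso.kerMax n α₁ α₂) C ∧
        OrliczIso.OrliczSobolev n (OrliczIso.Nmax n α₁ α₂) (OrliczIso.kerMin n α₁ α₂) C) ∧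
      OrliczIso.Sharp n (OrliczIso.Nmin n α₁ α₂) (OrliczIso.kerMax n α₁ α₂) ∧
      OrliczIso.Sharp n (OrliczIso.Nmax n α₁ α₂) (OrliczIso.kerMin n α₁ α₂)) ∧
    (∀ α q p : ℝ, 0 < α → α < 2 →
      (∃ lam₀ : ℝ, 2 ≤ lam₀ ∧ ∀ lam : ℝ, lam₀ ≤ lam →
        OrliczIso.IsYoung (OrliczIso.NlogPlus n α q lam) ∧
        OrliczIso.IsYoung (OrliczIso.NlogMinus n α p lam)) ∧
      ∀ lam : ℝ, 2 ≤ lam →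
        OrliczIso.IsYoung (OrliczIso.NlogPlus n α q lam) →
        OrliczIso.IsYoung (OrliczIso.NlogMinus n α p lam) →
        (∃ C : ℝ, 0 < C ∧
          OrliczIso.OrliczSobolev n (OrliczIso.NlogPlus n α q lam)
            (OrliczIso.kerLogPlus n α q) C ∧
          OrliczIso.OrliczSobolev n (OrliczIso.NlogMinus n α p lam)
            (OrliczIso.kerLogMinus n α p) C) ∧
        OrliczIso.Sharp n (OrliczIso.NlogPlus n α q lam) (OrliczIso.kerLogPlus n α q) ∧
        OrliczIso.Sharp n (OrliczIso.NlogMinus n α p lam) (OrliczIso.kerLogMinus n α p)) := by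
  refine ⟨fun α h hα _ hh => ⟨hh.exists_orliczSobolev hn hα, hh.iInf_perimeter_pos hn hα⟩,
    fun α₁ α₂ h₁ h₁' h₂ h₂' => ⟨?_, OrliczIso.sharp_Nmin hn h₁ h₁' h₂ h₂',
      OrliczIso.sharp_Nmax hn h₁ h₁' h₂ h₂'⟩,
    fun α q p hα hα' => ⟨OrliczIso.exists_isYoung_log hn hα hα' q p,
      fun lam hlam hplus hminus => ⟨?_, OrliczIso.sharp_NlogPlus hn hα hα' q hlam,
        OrliczIso.sharp_NlogMinus hn hα hα' p hlam⟩⟩⟩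
  · obtain ⟨C, hC, hmin⟩ := OrliczIso.exists_orliczSobolev_Nmin hn h₁ h₁' h₂ h₂'
    obtain ⟨C', -, hmax⟩ := OrliczIso.exists_orliczSobolev_Nmax hn h₁ h₁' h₂ h₂'
    exact ⟨max C C', lt_max_of_lt_left hC, hmin.mono (le_max_left _ _),
      hmax.mono (le_max_right _ _)⟩
  · obtain ⟨C, hC, hp⟩ := OrliczIso.exists_orliczSobolev_NlogPlus hn hα hα' q hlam hplus
    obtain ⟨C', -, hm⟩ := OrliczIso.exists_orliczSobolev_NlogMinus hn hα hα' p hlam hminus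
    exact ⟨max C C', lt_max_of_lt_left hC, hp.mono (le_max_left _ _),
      hm.mono (le_max_right _ _)⟩
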